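/- Let $A(t)=\sum_k a_k\mathbf 1_{\{t_k\le t\}}$, $t\ge 0$, be a marked Poisson process: $\{t_k\}$ is a Poisson point process on $(0,\infty)$ of intensity $\lambda>0$, and the marks $a_k$ are i.i.d. with values in $\{0,1,2,\dots\}$, independent of $\{t_k\}$, not almost surely $0$, with $g(z)=E[z^{a_k}]$, $|z|\le 1$. Let $0\le\tau_0\le\tau_1\le\cdots$ be a delayed renewal process independent of the process $A$: with $\tau_{-1}=0$, the times $\Delta_n=\tau_n-\tau_{n-1}$, $n\ge 0$, are nonnegative and independent, and $\Delta_1,\Delta_2,\dots$ are identically distributed and not almost surely $0$. Put $A_n=A(\tau_n)$, $A_{-1}=0$, $X_n=A_n-A_{n-1}$, $$\gamma_0(z,\vartheta)=E\big[z^{X_0}e^{-\vartheta\Delta_0}\big],\qquad \gamma(z,\vartheta)=E\big[z^{X_1}e^{-\vartheta\Delta_1}\big]\qquad(|z|\le 1,\ \operatorname{Re}\vartheta\ge 0).$$ Fix an integer threshold $p\ge 0$ and let $\nu=\inf\{n\ge 0: A_n>p\}$, which is almost surely finite. Let $u,v,y,w,x,\theta\in\mathbb C$ with $|u|,|v|,|y|\le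 1$, $\operatorname{Re}w,\operatorname{Re}x\ge 0$, $\operatorname{Re}\theta>0$ and $\theta+\lambda g(v)-\lambda g(vy)\ne 0$. For an interval-valued restriction $I\in\{\,\{t<\tau_\nu\},\ \{t<\tau_{\nu-1}\},\ \{\tau_{\nu-1}\le t<\tau_\nu\}\,\}$ put $$\int_0^\infty e^{-\theta t}\,E\Big[u^{A_{\nu-1}}v^{A_\nu}e^{-w\tau_{\nu-1}-x\Delta_\nu}\,y^{A(t)}\,\mathbf 1_I\Big]\,dt ,$$ and denote the three values by $G^*$, $G_1^*$, $G_2^*$ respectively. For $\varphi$ analytic at $0$ and an integer $k\ge 0$ let $\mathcal D_s^k\{\varphi(s)\}=\frac1{k!}\,\frac{d^k}{ds^k}\Big[\frac{\varphi(s)}{1-s}\Big]_{s=0}$. Finally let $$B_1=\frac{\gamma(v,x)-\gamma(vs,x)}{\theta+\lambda g(uvs)-\lambda g(uvys)},\quad B_2=\frac{\gamma_0(uvs,w)}{1-\gamma(uvs,w)},\quad B_3=\frac{\gamma_0(uvys,\theta+w)}{1-\gamma(uvys,\theta+w)},$$ $$\Gamma_0=\frac{\gamma_0(v,x)-\gamma_0(vy,\theta+x)}{\theta+\lambda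 g(v)-\lambda g(vy)}-\frac{\gamma_0(vs,x)-\gamma_0(vys,\theta+x)}{\theta+\lambda g(vs)-\lambda g(vys)},$$ $$\Gamma=\frac{\gamma(v,x)-\gamma(vy,\theta+x)}{\theta+\lambda g(v)-\lambda g(vy)}-\frac{\gamma(vs,x)-\gamma(vys,\theta+x)}{\theta+\lambda g(vs)-\lambda g(vys)}.$$ Then all these expectations and integrals converge absolutely, the function $s\mapsto B_1(B_2-B_3)+\Gamma_0+\Gamma B_3$ is analytic at $0$, and $$G^*=G_1^*+G_2^*=\mathcal D_s^{\,p}\big\{B_1(B_2-B_3)+\Gamma_0+\Gamma B_3\big\}.$$ In particular, for an integer $M\ge 1$ the operator $\mathcal D_s^{M-1}$ gives the functional for the exit index $\nu=\inf\{n: A_n>M-1\}=\inf\{n:A_n\ge M\}$, and $\mathcal D_s^{M}$ gives it for $\nu=\inf\{n:A_n>M\}$. -/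

import Mathlib

open MeasureTheory ProbabilityTheory Set
open scoped NNReal

noncomputable section

namespace DelayedPassage

variable {Ω : Type*} [MeasurableSpace Ω]

/-- The number of epochs `t k` in `[0, s]` (the epochs below are positive). -/
def count (t : ℕ → Ω → ℝ) (s : ℝ) (ω : Ω) : ℕ := {k | t k ω ≤ s}.ncard

/-- The marked point process `A(s) = ∑ₖ aₖ ε_{tₖ}[0, s]`: the sum of the marks `a k` over all the
epochs `t k` in `[0, s]`. -/
def markedProcess (t : ℕ → Ω → ℝ) (a : ℕ → Ω → ℕ) (s : ℝ) (ω : Ω) : ℕ :=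
  ∑' k, {r : ℝ | r ≤ s}.indicator (fun _ => a k ω) (t k ω)

/-- `(t k)` enumerates the points of a Poisson point process on `(0, ∞)` of intensity `lam`:
the points are almost surely positive and locally finite in number, and their counting process has
independent increments, that over `(r, s]` being Poisson with parameter `lam * (s - r)`.
No order of the points is prescribed. -/
structure IsPoissonPointProcess (P : Measure Ω) (lam : ℝ) (t : ℕ → Ω → ℝ) : Prop where
  measurable : ∀ k, Measurable (t k)
  pos : ∀ k, ∀ᵐ ω ∂P, 0 < t k ω
  locallyFinite : ∀ᵐ ω ∂P, ∀ s : ℝ, {k | t k ω ≤ s}.Finite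
  indepIncrements : HasIndepIncrements (fun (s : ℝ≥0) ω => count t s ω) P
  increment_law : ∀ r s : ℝ≥0, r ≤ s →
    HasLaw (fun ω => count t s ω - count t r ω) (poissonMeasure (lam.toNNReal * (s - r))) P

/-- Position independent marking of a Poisson point process: the marks `a k`, valued in
`{0, 1, 2, …}`, are independent, identically distributed, and independent of the epochs. -/
structure IsMarkedPoisson (P : Measure Ω) (lam : ℝ) (t : ℕ → Ω → ℝ) (a : ℕ → Ω → ℕ) : Prop where
  epochs : IsPoissonPointProcess P lam t
  measurable : ∀ k, Measurable (a k)
  indep : iIndepFun a P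
  identDistrib : ∀ k, IdentDistrib (a k) (a 0) P P
  indep_epochs : IndepFun (fun ω k => a k ω) (fun ω k => t k ω) P

/-- The previous term `f (n - 1)` of a sequence, with the convention `f (-1) = 0`. -/
def prev {α : Type*} [Zero α] (f : ℕ → Ω → α) : ℕ → Ω → α
  | 0 => fun _ => 0
  | n + 1 => f n

/-- The times between observations, `Δₙ = τₙ - τₙ₋₁` with `τ₋₁ = 0`. -/
def gap (τ : ℕ → Ω → ℝ) (n : ℕ) (ω : Ω) : ℝ := τ n ω - prev τ n ω

/-- `(τₙ)` is a delayed renewal process: the `Δₙ` are nonnegative and independent, and those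
with `n ≥ 1` are identically distributed. -/
structure IsDelayedRenewal (P : Measure Ω) (τ : ℕ → Ω → ℝ) : Prop where
  measurable : ∀ n, Measurable (τ n)
  gap_nonneg : ∀ n, ∀ᵐ ω ∂P, 0 ≤ gap τ n ω
  indep : iIndepFun (gap τ) P
  identDistrib : ∀ n, 1 ≤ n → IdentDistrib (gap τ n) (gap τ 1) P P

/-- The observed values `Aₙ = A(τₙ)`. -/
def observed (A : ℝ → Ω → ℕ) (τ : ℕ → Ω → ℝ) (n : ℕ) (ω : Ω) : ℕ := A (τ n ω) ω

/-- The observed increments `Xₙ = Aₙ - Aₙ₋₁` with `A₋₁ = 0`. The processes `A` used here are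
nondecreasing, so that the subtraction of natural numbers is the true one. -/
def increment (A : ℝ → Ω → ℕ) (τ : ℕ → Ω → ℝ) (n : ℕ) (ω : Ω) : ℕ :=
  observed A τ n ω - prev (observed A τ) n ω

/-- The exit index `ν(p) = inf {n ≥ 0 : Aₙ > p}`. -/
def exitIndex (A : ℝ → Ω → ℕ) (τ : ℕ → Ω → ℝ) (p : ℕ) (ω : Ω) : ℕ :=
  sInf {n | p < observed A τ n ω}

/-- The observation time `τ_ν` at the exit index. -/
def exitTime (A : ℝ → Ω → ℕ) (τ : ℕ → Ω → ℝ) (p : ℕ) (ω : Ω) : ℝ :=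
  τ (exitIndex A τ p ω) ω

/-- The observation time `τ_{ν-1}` just before the exit index. -/
def preExitTime (A : ℝ → Ω → ℕ) (τ : ℕ → Ω → ℝ) (p : ℕ) (ω : Ω) : ℝ :=
  prev τ (exitIndex A τ p ω) ω

/-- The random variable
`u^{A_{ν-1}} v^{A_ν} exp(-w τ_{ν-1} - x Δ_ν) y^{A(r)} 1_{lo ≤ r < hi}`. -/
def integrand (A : ℝ → Ω → ℕ) (τ : ℕ → Ω → ℝ) (p : ℕ) (u v w x y : ℂ) (lo hi : Ω → ℝ)
    (r : ℝ) (ω : Ω) : ℂ :=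
  u ^ prev (observed A τ) (exitIndex A τ p ω) ω * v ^ observed A τ (exitIndex A τ p ω) ω *
    Complex.exp (-w * preExitTime A τ p ω - x * gap τ (exitIndex A τ p ω) ω) *
    y ^ A r ω * (Ico (lo ω) (hi ω)).indicator (fun _ => (1 : ℂ)) r

/-- The functional `G₁`, restricted to `r < τ_{ν-1}`, as a function of real time `r ≥ 0`. -/
def G₁ (P : Measure Ω) (A : ℝ → Ω → ℕ) (τ : ℕ → Ω → ℝ) (p : ℕ) (u v w x y : ℂ) (r : ℝ) : ℂ :=
  ∫ ω, integrand A τ p u v w x y (fun _ => 0) (preExitTime A τ p) r ω ∂P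

/-- The functional `G₂`, restricted to `τ_{ν-1} ≤ r < τ_ν`. -/
def G₂ (P : Measure Ω) (A : ℝ → Ω → ℕ) (τ : ℕ → Ω → ℝ) (p : ℕ) (u v w x y : ℂ) (r : ℝ) : ℂ :=
  ∫ ω, integrand A τ p u v w x y (preExitTime A τ p) (exitTime A τ p) r ω ∂P

/-- The functional `G`, restricted to `r < τ_ν`, as a function of real time `r ≥ 0`. -/
def G (P : Measure Ω) (A : ℝ → Ω → ℕ) (τ : ℕ → Ω → ℝ) (p : ℕ) (u v w x y : ℂ) (r : ℝ) : ℂ :=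
  ∫ ω, integrand A τ p u v w x y (fun _ => 0) (exitTime A τ p) r ω ∂P

/-- The Laplace transform `∫_{t ≥ 0} exp(-θ t) f(t) dt`. -/
def laplace (f : ℝ → ℂ) (θ : ℂ) : ℂ := ∫ r in Ici (0 : ℝ), Complex.exp (-θ * r) * f r

/-- Convergence of the integral that defines the Laplace transform. -/
def LaplaceConverges (f : ℝ → ℂ) (θ : ℂ) : Prop :=
  IntegrableOn (fun r : ℝ => Complex.exp (-θ * r) * f r) (Ici 0)

/-- The probability generating function `E[z^X]`. -/
def pgf (P : Measure Ω) (X : Ω → ℕ) (z : ℂ) : ℂ := ∫ ω, z ^ X ω ∂P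

/-- The joint transform `E[z^{Xₙ} exp(-θ Δₙ)]` of the `n`-th observed increment and the `n`-th time
between observations: `γ₀` is the case `n = 0` and `γ` is the case `n = 1`. -/
def jointTransform (P : Measure Ω) (A : ℝ → Ω → ℕ) (τ : ℕ → Ω → ℝ) (n : ℕ) (z θ : ℂ) : ℂ :=
  ∫ ω, z ^ increment A τ n ω * Complex.exp (-θ * gap τ n ω) ∂P

/-- The operator `𝒟_s^k φ = (1/k!) (d/ds)^k [φ(s) / (1 - s)]` at `s = 0`, for `φ` analytic at 0. -/
def Dinv (k : ℕ) (φ : ℂ → ℂ) : ℂ :=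
  iteratedDeriv k (fun s => 1 / (1 - s) * φ s) 0 / (k.factorial : ℂ)

/-! The expressions `B₁, B₂, B₃, Γ₀, Γ`, as functions of `s` and of the transforms
`g`, `γ₀`, `γ`. -/

def B₁ (lam : ℝ) (g : ℂ → ℂ) (γ : ℂ → ℂ → ℂ) (θ u v x y s : ℂ) : ℂ :=
  (γ v x - γ (v * s) x) / (θ + lam * g (u * v * s) - lam * g (u * v * y * s))

def B₂ (γ₀ γ : ℂ → ℂ → ℂ) (u v w s : ℂ) : ℂ :=
  γ₀ (u * v * s) w / (1 - γ (u * v * s) w)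

def B₃ (γ₀ γ : ℂ → ℂ → ℂ) (θ u v w y s : ℂ) : ℂ :=
  γ₀ (u * v * y * s) (θ + w) / (1 - γ (u * v * y * s) (θ + w))

/-- Applied to `η = γ₀` this is `Γ₀`, and applied to `η = γ` it is `Γ`. -/
def Γof (lam : ℝ) (g : ℂ → ℂ) (η : ℂ → ℂ → ℂ) (θ v x y s : ℂ) : ℂ :=
  (η v x - η (v * y) (θ + x)) / (θ + lam * g v - lam * g (v * y)) -
    (η (v * s) x - η (v * y * s) (θ + x)) / (θ + lam * g (v * s) - lam * g (v * y * s))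

/-- The function `s ↦ B₁ (B₂ - B₃) + Γ₀ + Γ B₃`. -/
def kernelFun (lam : ℝ) (g : ℂ → ℂ) (γ₀ γ : ℂ → ℂ → ℂ) (θ u v w x y s : ℂ) : ℂ :=
  B₁ lam g γ θ u v x y s * (B₂ γ₀ γ u v w s - B₃ γ₀ γ θ u v w y s) +
    Γof lam g γ₀ θ v x y s + Γof lam g γ θ v x y s * B₃ γ₀ γ θ u v w y s

end DelayedPassage

end

/-! Write ξ(z) = λ(1 - g(z)), which is `exponent`. Given the observation times, the increments of
`A` over consecutive intervals of lengths ℓᵢ have joint generating function exp(-Σ ξ(zᵢ) ℓᵢ). This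
is `IsMarkedPoisson.integral_pow_randomTime`: freeze the times, then the epochs, and average over
the marks. Hence for a fixed index n every expectation with factors u^{Aₙ₋₁} v^{Aₙ} y^{A(r)} becomes
an expectation of exponentials in τₙ₋₁ and Δₙ. Integrating over r and factoring by independence of
the gaps gives `integral_before` and `integral_between`.

The random index is removed by a generating function over all thresholds at once. Since ν(p) = n
exactly when Aₙ₋₁ ≤ p < Aₙ, summing s^p over each block gives (1 - s) Σₚ s^p k(ν(p)) = Σₙ
k(n)(s^{Aₙ₋₁} - s^{Aₙ}), which is `hasSum_exit`. The factor s^{Aₙ₋₁} only replaces u by us, and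
s^{Aₙ} only replaces v by vs, so the right side consists of fixed-index transforms
(`exists_hasSum`). Their sum over n is a term for n = 0, equal to Γ₀, plus geometric series that
produce B₂ and B₃ (`hasSum_kernelFun`).

So near s = 0 the series Σₚ s^p G*(p) equals the kernel divided by 1 - s, and `Dinv p` reads off its
p-th coefficient. -/

noncomputable section

namespace DelayedPassage

/-! ### Path properties of the marked point process -/

section Paths

variable {Ω : Type*} {t : ℕ → Ω → ℝ} {a : ℕ → Ω → ℕ}

/-- Measurability is joint in time and outcome, since random times are substituted and Fubini is
used over time and outcome. -/
theorem measurable_markedProcess [MeasurableSpace Ω] (ht : ∀ k, Measurable (t k))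
    (ha : ∀ k, Measurable (a k)) :
    Measurable fun q : ℝ × Ω => markedProcess t a q.1 q.2 := by
  unfold markedProcess
  refine Measurable.tsum fun k => ?_
  have h : (fun q : ℝ × Ω => {r : ℝ | r ≤ q.1}.indicator (fun _ => a k q.2) (t k q.2)) =
      {q : ℝ × Ω | t k q.2 ≤ q.1}.indicator (fun q => a k q.2) := by
    ext q
    simp [Set.indicator_apply]
  rw [h]
  exact ((ha k).comp measurable_snd).indicator
    (measurableSet_le ((ht k).comp measurable_snd) measurable_fst)

/-- The paths on which the epochs are positive and locally finite in number. -/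
def IsRegularPath (t : ℕ → Ω → ℝ) (ω : Ω) : Prop :=
  (∀ k, 0 < t k ω) ∧ ∀ s : ℝ, {k | t k ω ≤ s}.Finite

theorem IsRegularPath.markedProcess_eq {ω : Ω} (h : IsRegularPath t ω) (s : ℝ) :
    markedProcess t a s ω = ∑ k ∈ (h.2 s).toFinset, a k ω := by
  unfold markedProcess
  rw [tsum_eq_sum' (s := (h.2 s).toFinset)]
  · refine Finset.sum_congr rfl fun k hk => ?_
    have : t k ω ≤ s := by simpa using hk
    simp [this]
  · intro k hk
    by_contra hc
    simp_all

theorem IsRegularPath.mono {ω : Ω} (h : IsRegularPath t ω) {r s : ℝ} (hrs : r ≤ s) :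
    markedProcess t a r ω ≤ markedProcess t a s ω := by
  rw [h.markedProcess_eq, h.markedProcess_eq]
  refine Finset.sum_le_sum_of_subset fun k hk => ?_
  simp only [Finite.mem_toFinset, mem_ofPred_eq] at hk ⊢
  exact hk.trans hrs

theorem IsRegularPath.zero {ω : Ω} (h : IsRegularPath t ω) : markedProcess t a 0 ω = 0 := by
  rw [h.markedProcess_eq]
  refine Finset.sum_eq_zero fun k hk => ?_
  have : t k ω ≤ 0 := by simpa using hk
  exact absurd (h.1 k) (not_lt.2 this)

/-- The point of the grid of mesh `1 / (n + 1)` next after `s`. -/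
def gridPoint (n m : ℕ) : ℝ≥0 := (m + 1) / (n + 1)

theorem lt_gridPoint {s : ℝ} (n : ℕ) :
    s < gridPoint n ⌊s * (n + 1)⌋₊ := by
  unfold gridPoint
  push_cast
  rw [lt_div_iff₀ (by positivity)]
  exact Nat.lt_floor_add_one _

theorem gridPoint_le {s : ℝ} (hs : 0 ≤ s) (n : ℕ) :
    (gridPoint n ⌊s * (n + 1)⌋₊ : ℝ) ≤ s + 1 / (n + 1) := by
  unfold gridPoint
  push_cast
  rw [add_div]
  have := Nat.floor_le (a := s * (n + 1)) (by positivity)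
  gcongr
  rwa [div_le_iff₀ (by positivity)]

/-- The value at `s` of a nondecreasing right continuous path, read off from its values on a
countable set of times. -/
def evalRight (f : ℝ≥0 → ℕ) (s : ℝ) : ℕ := ⨅ n : ℕ, f (gridPoint n ⌊s * (n + 1)⌋₊)

/-- Independence of `A` and the observation times is expressed on the path space with its product
σ-algebra, where evaluation at a variable real time is not jointly measurable. `evalRight` consults
only countably many coordinates, so it is. -/
theorem measurable_evalRight : Measurable fun q : (ℝ≥0 → ℕ) × ℝ => evalRight q.1 q.2 := by
  unfold evalRight
  refine Measurable.iInf fun n => ?_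
  have h : Measurable fun q : (ℝ≥0 → ℕ) × ℕ => q.1 (gridPoint n q.2) :=
    measurable_from_prod_countable_left fun m =>
      measurable_pi_apply (gridPoint n m)
  exact h.comp (measurable_fst.prodMk (Nat.measurable_floor.comp (measurable_snd.mul_const _)))

-- Right continuity: only finitely many epochs lie below s + 1, so for a fine enough grid none lies
-- in (s, s + 1/(n+1)], and the grid value equals the value at s.
open Filter Topology in
theorem IsRegularPath.evalRight_eq {ω : Ω} (h : IsRegularPath t ω) {s : ℝ} (hs : 0 ≤ s) :
    evalRight (fun r => markedProcess t a r ω) s = markedProcess t a s ω := by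
  have hlim : Tendsto (fun n : ℕ => s + 1 / ((n : ℝ) + 1)) atTop (𝓝 s) := by
    simpa using tendsto_const_nhds.add (tendsto_one_div_add_atTop_nhds_zero_nat (𝕜 := ℝ))
  have hev : ∀ᶠ n : ℕ in atTop, ∀ k ∈ {k | t k ω ≤ s + 1},
      (t k ω ≤ s + 1 / ((n : ℝ) + 1) → t k ω ≤ s) := by
    rw [eventually_all_finite (h.2 (s + 1))]
    intro k _
    by_cases hk : t k ω ≤ s
    · exact Eventually.of_forall fun _ _ => hk
    · filter_upwards [hlim.eventually (gt_mem_nhds (not_le.1 hk))] with n hn hc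
      exact absurd hn (not_lt.2 hc)
  obtain ⟨n, hn⟩ := hev.exists
  refine le_antisymm ?_ (le_ciInf fun n => h.mono (lt_gridPoint n).le)
  refine (ciInf_le (OrderBot.bddBelow _) n).trans ?_
  change markedProcess t a (gridPoint n ⌊s * (n + 1)⌋₊) ω ≤ _
  rw [h.markedProcess_eq, h.markedProcess_eq]
  refine Finset.sum_le_sum_of_subset fun k hk => ?_
  simp only [Finite.mem_toFinset, mem_ofPred_eq] at hk ⊢
  have h1 : t k ω ≤ s + 1 / ((n : ℝ) + 1) := hk.trans (gridPoint_le hs n)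
  refine hn k ?_ h1
  have : 1 / ((n : ℝ) + 1) ≤ 1 := by
    rw [div_le_one (by positivity)]
    linarith [(Nat.cast_nonneg n : (0 : ℝ) ≤ n)]
  simp only [mem_ofPred_eq]
  linarith

/-- Regrouping by points gives each mark the base of the interval containing its epoch, so
independent marks can be averaged factor by factor. The marks are a deterministic sequence `b`
because epochs and marks will be drawn from separate outcomes. -/
theorem IsRegularPath.pow_increments {ω : Ω} (h : IsRegularPath t ω) (b : ℕ → ℕ)
    {s₁ s₂ s₃ : ℝ} (h12 : s₁ ≤ s₂) (h23 : s₂ ≤ s₃) (z₁ z₂ z₃ : ℂ) :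
    z₁ ^ markedProcess t (fun k _ => b k) s₁ ω *
      z₂ ^ (markedProcess t (fun k _ => b k) s₂ ω - markedProcess t (fun k _ => b k) s₁ ω) *
      z₃ ^ (markedProcess t (fun k _ => b k) s₃ ω - markedProcess t (fun k _ => b k) s₂ ω) =
    ∏ k ∈ (h.2 s₃).toFinset,
      (if t k ω ≤ s₁ then z₁ else if t k ω ≤ s₂ then z₂ else z₃) ^ b k := by
  classical
  simp only [h.markedProcess_eq]
  set K₁ := (h.2 s₁).toFinset with hK₁
  set K₂ := (h.2 s₂).toFinset with hK₂
  set K₃ := (h.2 s₃).toFinset with hK₃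
  have hs1 : K₁ ⊆ K₂ := by
    intro k hk
    simp only [hK₁, hK₂, Finite.mem_toFinset, mem_ofPred_eq] at hk ⊢
    exact hk.trans h12
  have hs2 : K₂ ⊆ K₃ := by
    intro k hk
    simp only [hK₃, hK₂, Finite.mem_toFinset, mem_ofPred_eq] at hk ⊢
    exact hk.trans h23
  rw [← Finset.sum_sdiff hs1, ← Finset.sum_sdiff hs2, ← Finset.sum_sdiff hs1,
    ← Finset.prod_sdiff hs2, ← Finset.prod_sdiff hs1, Nat.add_sub_cancel, Nat.add_sub_cancel]
  have e1 : ∏ k ∈ K₁, (if t k ω ≤ s₁ then z₁ else if t k ω ≤ s₂ then z₂ else z₃) ^ b k =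
      z₁ ^ ∑ k ∈ K₁, b k := by
    rw [← Finset.prod_pow_eq_pow_sum]
    refine Finset.prod_congr rfl fun k hk => ?_
    have : t k ω ≤ s₁ := by simpa [hK₁] using hk
    simp [this]
  have e2 : ∏ k ∈ K₂ \ K₁, (if t k ω ≤ s₁ then z₁ else if t k ω ≤ s₂ then z₂ else z₃) ^ b k =
      z₂ ^ ∑ k ∈ K₂ \ K₁, b k := by
    rw [← Finset.prod_pow_eq_pow_sum]
    refine Finset.prod_congr rfl fun k hk => ?_
    have : t k ω ≤ s₂ ∧ ¬ t k ω ≤ s₁ := by simpa [hK₁, hK₂] using hk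
    simp only [this, if_true, if_false]
  have e3 : ∏ k ∈ K₃ \ K₂, (if t k ω ≤ s₁ then z₁ else if t k ω ≤ s₂ then z₂ else z₃) ^ b k =
      z₃ ^ ∑ k ∈ K₃ \ K₂, b k := by
    rw [← Finset.prod_pow_eq_pow_sum]
    refine Finset.prod_congr rfl fun k hk => ?_
    have h' : t k ω ≤ s₃ ∧ ¬ t k ω ≤ s₂ := by simpa [hK₃, hK₂] using hk
    have : ¬ t k ω ≤ s₁ := fun hc => h'.2 (hc.trans h12)
    simp only [this, h', if_false]
  rw [e1, e2, e3]
  ring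

theorem IsRegularPath.count_eq {ω : Ω} (h : IsRegularPath t ω) (s : ℝ) :
    count t s ω = markedProcess t (fun _ _ => 1) s ω := by
  rw [h.markedProcess_eq]
  simp [count, ncard_eq_toFinset_card _ (h.2 s)]

/-- Regrouping in the other direction, after the marks have been averaged: this is `pow_increments`
with unit marks and bases g(zᵢ). -/
theorem IsRegularPath.prod_pgf {ω : Ω} (h : IsRegularPath t ω)
    {s₁ s₂ s₃ : ℝ} (h12 : s₁ ≤ s₂) (h23 : s₂ ≤ s₃) (z₁ z₂ z₃ : ℂ) (g : ℂ → ℂ) :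
    ∏ k ∈ (h.2 s₃).toFinset,
      g (if t k ω ≤ s₁ then z₁ else if t k ω ≤ s₂ then z₂ else z₃) =
    g z₁ ^ count t s₁ ω * g z₂ ^ (count t s₂ ω - count t s₁ ω) *
      g z₃ ^ (count t s₃ ω - count t s₂ ω) := by
  simp only [h.count_eq]
  rw [h.pow_increments (fun _ => 1) h12 h23 (g z₁) (g z₂) (g z₃)]
  refine Finset.prod_congr rfl fun k _ => ?_
  split_ifs <;> simp

end Paths

/-! ### Decoupling of independent variables -/

section Independence

variable {Ω : Type*} [MeasurableSpace Ω] {P : Measure Ω} [IsProbabilityMeasure P]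

/-- The expectation of a function of two independent variables may be computed with two
independent sources of randomness. -/
theorem integral_of_indepFun {α β : Type*} [MeasurableSpace α] [MeasurableSpace β]
    {X : Ω → α} {Y : Ω → β} (hXY : IndepFun X Y P) (hX : Measurable X) (hY : Measurable Y)
    {F : α × β → ℂ} (hF : Measurable F) (hb : Integrable (fun ω => F (X ω, Y ω)) P) :
    ∫ ω, F (X ω, Y ω) ∂P = ∫ ω, ∫ ω', F (X ω, Y ω') ∂P ∂P := by
  have hm := (indepFun_iff_map_prod_eq_prod_map_map hX.aemeasurable hY.aemeasurable).1 hXY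
  have : IsProbabilityMeasure (P.map X) := Measure.isProbabilityMeasure_map hX.aemeasurable
  have : IsProbabilityMeasure (P.map Y) := Measure.isProbabilityMeasure_map hY.aemeasurable
  have hI : Integrable F ((P.map X).prod (P.map Y)) := by
    rw [← hm, integrable_map_measure hF.aestronglyMeasurable (hX.prodMk hY).aemeasurable]
    exact hb
  rw [← integral_map (φ := fun ω => (X ω, Y ω)) (hX.prodMk hY).aemeasurable
    hF.aestronglyMeasurable, hm, integral_prod _ hI, integral_map hX.aemeasurable]
  · refine integral_congr_ae (Filter.Eventually.of_forall fun ω => ?_)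
    exact integral_map hY.aemeasurable (hF.comp measurable_prodMk_left).aestronglyMeasurable
  · exact hI.aestronglyMeasurable.integral_prod_right'

end Independence

theorem IsRegularPath.count_zero {Ω : Type*} {t : ℕ → Ω → ℝ} {ω : Ω} (h : IsRegularPath t ω) :
    count t 0 ω = 0 := by
  rw [h.count_eq, h.zero]

theorem norm_pow_le_one {z : ℂ} (hz : ‖z‖ ≤ 1) (n : ℕ) : ‖z ^ n‖ ≤ 1 := by
  rw [norm_pow]
  exact pow_le_one₀ (norm_nonneg _) hz

theorem norm_mul_le_one {z w : ℂ} (hz : ‖z‖ ≤ 1) (hw : ‖w‖ ≤ 1) : ‖z * w‖ ≤ 1 := by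
  rw [norm_mul]
  exact mul_le_one₀ hz (norm_nonneg _) hw

/-! ### Generating functions of Poisson counts and of the marks -/

section Measurability

variable {Ω : Type*} [MeasurableSpace Ω] {P : Measure Ω}

theorem pgf_poisson {N : Ω → ℕ} {μ : ℝ≥0} (hN : HasLaw N (poissonMeasure μ) P) (z : ℂ) :
    pgf P N z = Complex.exp (-(μ * (1 - z))) := by
  unfold pgf
  rw [← integral_map (φ := N) (f := fun n => z ^ n) hN.aemeasurable
    (measurable_from_top.aestronglyMeasurable), hN.map_eq, integral_poissonMeasure]
  have h : ∀ n : ℕ, (Real.exp (-μ) * (μ : ℝ) ^ n / (n.factorial : ℝ)) • z ^ n =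
      Complex.exp (-μ) * ((μ * z) ^ n / n.factorial) := by
    intro n
    rw [Complex.real_smul]
    push_cast
    rw [mul_pow]
    ring
  simp_rw [h]
  rw [tsum_mul_left, (NormedSpace.expSeries_div_hasSum_exp ((μ : ℂ) * z)).tsum_eq,
    ← Complex.exp_eq_exp_ℂ, ← Complex.exp_add]
  congr 1
  ring

theorem IsPoissonPointProcess.ae_isRegularPath {lam : ℝ} {t : ℕ → Ω → ℝ}
    (h : IsPoissonPointProcess P lam t) : ∀ᵐ ω ∂P, IsRegularPath t ω := by
  filter_upwards [ae_all_iff.2 h.pos, h.locallyFinite] with ω h1 h2 using ⟨h1, h2⟩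

theorem IsMarkedPoisson.measurable_process {lam : ℝ} {t : ℕ → Ω → ℝ} {a : ℕ → Ω → ℕ}
    (hA : IsMarkedPoisson P lam t a) :
    Measurable fun q : ℝ × Ω => markedProcess t a q.1 q.2 :=
  measurable_markedProcess hA.epochs.measurable hA.measurable

theorem IsMarkedPoisson.measurable_process_at {lam : ℝ} {t : ℕ → Ω → ℝ} {a : ℕ → Ω → ℕ}
    (hA : IsMarkedPoisson P lam t a) {S : Ω → ℝ}
    (hS : Measurable S) : Measurable fun ω => markedProcess t a (S ω) ω :=
  hA.measurable_process.comp (hS.prodMk measurable_id)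

/-- The joint generating function of the increments of a Poisson counting process. -/
theorem IsPoissonPointProcess.integral_pow_count {lam : ℝ} (hlam : 0 < lam) {t : ℕ → Ω → ℝ}
    (h : IsPoissonPointProcess P lam t) {s₁ s₂ s₃ : ℝ} (h0 : 0 ≤ s₁) (h12 : s₁ ≤ s₂)
    (h23 : s₂ ≤ s₃) (q₁ q₂ q₃ : ℂ) :
    ∫ ω, q₁ ^ count t s₁ ω * q₂ ^ (count t s₂ ω - count t s₁ ω) *
      q₃ ^ (count t s₃ ω - count t s₂ ω) ∂P =
    Complex.exp (-(lam * (1 - q₁) * s₁ + lam * (1 - q₂) * (s₂ - s₁) +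
      lam * (1 - q₃) * (s₃ - s₂))) := by
  lift s₁ to ℝ≥0 using h0
  lift s₂ to ℝ≥0 using s₁.2.trans h12
  lift s₃ to ℝ≥0 using s₂.2.trans h23
  rw [NNReal.coe_le_coe] at h12 h23
  -- The initial point 0 makes the count up to s₁ an increment too, since the count at 0 vanishes
  -- almost surely.
  let T : Fin 4 → ℝ≥0 := ![0, s₁, s₂, s₃]
  have hT : Monotone T := by
    rw [Fin.monotone_iff_le_succ]
    intro i
    fin_cases i <;> simp [T, h12, h23]
  have hind := h.indepIncrements 3 T hT
  have hlaw : ∀ i : Fin 3, HasLaw (fun ω => count t (T i.succ) ω - count t (T i.castSucc) ω)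
      (poissonMeasure (lam.toNNReal * (T i.succ - T i.castSucc))) P := fun i =>
    h.increment_law _ _ (hT (Fin.castSucc_lt_succ).le)
  have hprod := hind.integral_fun_prod_comp (𝕜 := ℂ) (f := fun i n => ![q₁, q₂, q₃] i ^ n)
    (fun i => (hlaw i).aemeasurable) (fun i => measurable_from_top.aestronglyMeasurable)
  have he : ∀ i : Fin 3, ∫ ω, ![q₁, q₂, q₃] i ^
      (count t (T i.succ) ω - count t (T i.castSucc) ω) ∂P = _ := fun i =>
    pgf_poisson (hlaw i) (![q₁, q₂, q₃] i)
  rw [Finset.prod_congr rfl fun i _ => he i] at hprod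
  rw [Fin.prod_univ_three, ← Complex.exp_add, ← Complex.exp_add] at hprod
  refine Eq.trans ?_ (hprod.trans ?_)
  · refine integral_congr_ae ?_
    filter_upwards [h.ae_isRegularPath] with ω hω
    simp [Fin.prod_univ_three, T, hω.count_zero]
  · congr 1
    simp [T, NNReal.coe_sub h12, NNReal.coe_sub h23, hlam.le]
    ring

theorem integral_prod_marks {lam : ℝ} {t : ℕ → Ω → ℝ} {a : ℕ → Ω → ℕ}
    (hA : IsMarkedPoisson P lam t a) (K : Finset ℕ) (z : ℕ → ℂ) :
    ∫ ω, ∏ k ∈ K, z k ^ a k ω ∂P = ∏ k ∈ K, pgf P (a 0) (z k) := by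
  have h := (hA.indep.precomp (g := fun k : K => (k : ℕ)) Subtype.val_injective)
  have h2 := iIndepFun.integral_fun_prod_comp (𝕜 := ℂ) h (f := fun (k : K) n => z k ^ n)
    (fun i => (hA.measurable i).aemeasurable) (fun i => measurable_from_top.aestronglyMeasurable)
  rw [← Finset.prod_coe_sort K (fun k => pgf P (a 0) (z k))]
  simp_rw [← Finset.prod_coe_sort K (fun k => z k ^ a k _)]
  refine h2.trans (Finset.prod_congr rfl fun k _ => ?_)
  exact ((hA.identDistrib k).comp (u := fun n : ℕ => z k ^ n) measurable_from_top).integral_eq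

end Measurability

/-! ### Generating functions of the marked process at fixed and at random times -/

section Transform

variable {Ω : Type*} [MeasurableSpace Ω] {P : Measure Ω} [IsProbabilityMeasure P]

theorem norm_pgf_le_one (X : Ω → ℕ) {z : ℂ} (hz : ‖z‖ ≤ 1) : ‖pgf P X z‖ ≤ 1 := by
  refine (norm_integral_le_of_norm_le_const (C := 1) (Filter.Eventually.of_forall fun ω => ?_)).trans
    (by simp)
  rw [norm_pow]
  exact pow_le_one₀ (norm_nonneg _) hz

variable {lam : ℝ} {t : ℕ → Ω → ℝ} {a : ℕ → Ω → ℕ}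

/-- The exponent of the marked Poisson process: `E[z^{A(r)}] = exp (-r * exponent z)`. -/
def exponent (P : Measure Ω) (lam : ℝ) (a : ℕ → Ω → ℕ) (z : ℂ) : ℂ := lam * (1 - pgf P (a 0) z)

theorem integrable_of_norm_le_one {f : Ω → ℂ} (hf : Measurable f) (hb : ∀ᵐ ω ∂P, ‖f ω‖ ≤ 1) :
    Integrable f P :=
  Integrable.of_bound hf.aestronglyMeasurable 1 hb

/-- The joint generating function of the increments of a marked Poisson process. -/
theorem IsMarkedPoisson.integral_pow (hlam : 0 < lam) (hA : IsMarkedPoisson P lam t a)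
    {s₁ s₂ s₃ : ℝ} (h0 : 0 ≤ s₁) (h12 : s₁ ≤ s₂) (h23 : s₂ ≤ s₃) {z₁ z₂ z₃ : ℂ}
    (hz₁ : ‖z₁‖ ≤ 1) (hz₂ : ‖z₂‖ ≤ 1) (hz₃ : ‖z₃‖ ≤ 1) :
    ∫ ω, z₁ ^ markedProcess t a s₁ ω *
      z₂ ^ (markedProcess t a s₂ ω - markedProcess t a s₁ ω) *
      z₃ ^ (markedProcess t a s₃ ω - markedProcess t a s₂ ω) ∂P =
    Complex.exp (-(exponent P lam a z₁ * s₁ + exponent P lam a z₂ * (s₂ - s₁) +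
      exponent P lam a z₃ * (s₃ - s₂))) := by
  -- The process is rebuilt on the space of (epochs, marks) sequences, so that the integrand is a
  -- function of two independent variables.
  let M : ℝ → (ℕ → ℝ) × (ℕ → ℕ) → ℕ := markedProcess (fun k q => q.1 k) (fun k q => q.2 k)
  have hM : ∀ s, Measurable (M s) := fun s =>
    (measurable_markedProcess (t := fun k (q : (ℕ → ℝ) × (ℕ → ℕ)) => q.1 k)
      (a := fun k q => q.2 k) (fun k => (measurable_pi_apply k).comp measurable_fst)
      (fun k => (measurable_pi_apply k).comp measurable_snd)).comp
      (measurable_const.prodMk measurable_id)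
  let F : (ℕ → ℝ) × (ℕ → ℕ) → ℂ := fun q =>
    z₁ ^ M s₁ q * z₂ ^ (M s₂ q - M s₁ q) * z₃ ^ (M s₃ q - M s₂ q)
  have hpow : ∀ (z : ℂ) (N : (ℕ → ℝ) × (ℕ → ℕ) → ℕ), Measurable N → Measurable fun q => z ^ N q :=
    fun z N hN => (measurable_from_top (f := fun n : ℕ => z ^ n)).comp hN
  have hF : Measurable F :=
    ((hpow _ _ (hM s₁)).mul (hpow _ _ ((hM s₂).sub (hM s₁)))).mul
      (hpow _ _ ((hM s₃).sub (hM s₂)))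
  have hX : Measurable fun ω k => t k ω := measurable_pi_lambda _ hA.epochs.measurable
  have hY : Measurable fun ω k => a k ω := measurable_pi_lambda _ hA.measurable
  have hdec := integral_of_indepFun hA.indep_epochs.symm hX hY hF
    (integrable_of_norm_le_one (hF.comp (hX.prodMk hY)) (Filter.Eventually.of_forall fun ω =>
      norm_mul_le_one (norm_mul_le_one (norm_pow_le_one hz₁ _) (norm_pow_le_one hz₂ _))
        (norm_pow_le_one hz₃ _)))
  refine Eq.trans ?_ (hdec.trans ?_)
  · rfl
  · unfold exponent
    rw [← hA.epochs.integral_pow_count hlam h0 h12 h23]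
    refine integral_congr_ae ?_
    filter_upwards [hA.epochs.ae_isRegularPath] with ω hω
    rw [← hω.prod_pgf h12 h23, ← integral_prod_marks hA]
    congr 1
    ext ω'
    exact hω.pow_increments (fun k => a k ω') h12 h23 z₁ z₂ z₃

/-- The joint generating function of the increments of a marked Poisson process between random
times that are independent of the process. -/
theorem IsMarkedPoisson.integral_pow_randomTime (hlam : 0 < lam) (hA : IsMarkedPoisson P lam t a)
    {S₁ S₂ S₃ : Ω → ℝ} {W : Ω → ℂ} (hS₁ : Measurable S₁) (hS₂ : Measurable S₂)
    (hS₃ : Measurable S₃) (hW : Measurable W)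
    (hind : IndepFun (fun ω => (W ω, S₁ ω, S₂ ω, S₃ ω))
      (fun ω (s : ℝ≥0) => markedProcess t a s ω) P)
    (hS : ∀ᵐ ω ∂P, 0 ≤ S₁ ω ∧ S₁ ω ≤ S₂ ω ∧ S₂ ω ≤ S₃ ω) (hWb : ∀ᵐ ω ∂P, ‖W ω‖ ≤ 1)
    {z₁ z₂ z₃ : ℂ} (hz₁ : ‖z₁‖ ≤ 1) (hz₂ : ‖z₂‖ ≤ 1) (hz₃ : ‖z₃‖ ≤ 1) :
    ∫ ω, W ω * (z₁ ^ markedProcess t a (S₁ ω) ω *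
      z₂ ^ (markedProcess t a (S₂ ω) ω - markedProcess t a (S₁ ω) ω) *
      z₃ ^ (markedProcess t a (S₃ ω) ω - markedProcess t a (S₂ ω) ω)) ∂P =
    ∫ ω, W ω * Complex.exp (-(exponent P lam a z₁ * S₁ ω +
      exponent P lam a z₂ * (S₂ ω - S₁ ω) + exponent P lam a z₃ * (S₃ ω - S₂ ω))) ∂P := by
  -- The weight and the times form one variable, the whole path the other; `evalRight` makes the
  -- function measurable in both.
  let F : (ℂ × ℝ × ℝ × ℝ) × (ℝ≥0 → ℕ) → ℂ := fun q =>
    q.1.1 * (z₁ ^ evalRight q.2 q.1.2.1 *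
      z₂ ^ (evalRight q.2 q.1.2.2.1 - evalRight q.2 q.1.2.1) *
      z₃ ^ (evalRight q.2 q.1.2.2.2 - evalRight q.2 q.1.2.2.1))
  have hpow : ∀ (z : ℂ) (N : (ℂ × ℝ × ℝ × ℝ) × (ℝ≥0 → ℕ) → ℕ), Measurable N →
      Measurable fun q => z ^ N q :=
    fun z N hN => (measurable_from_top (f := fun n : ℕ => z ^ n)).comp hN
  have hev : ∀ S : (ℂ × ℝ × ℝ × ℝ) × (ℝ≥0 → ℕ) → ℝ, Measurable S →
      Measurable fun q : (ℂ × ℝ × ℝ × ℝ) × (ℝ≥0 → ℕ) => evalRight q.2 (S q) := fun S hS =>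
    measurable_evalRight.comp (measurable_snd.prodMk hS)
  have e1 := hev (fun q => q.1.2.1) (by fun_prop)
  have e2 := hev (fun q => q.1.2.2.1) (by fun_prop)
  have e3 := hev (fun q => q.1.2.2.2) (by fun_prop)
  have hF : Measurable F :=
    (measurable_fst.comp measurable_fst).mul
      (((hpow _ _ e1).mul (hpow _ _ (e2.sub e1))).mul (hpow _ _ (e3.sub e2)))
  have hX : Measurable fun ω => (W ω, S₁ ω, S₂ ω, S₃ ω) := by fun_prop
  have hY : Measurable fun ω (s : ℝ≥0) => markedProcess t a s ω :=
    measurable_pi_lambda _ fun s => hA.measurable_process_at measurable_const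
  have hdec := integral_of_indepFun hind hX hY hF
    (integrable_of_norm_le_one (hF.comp (hX.prodMk hY)) (by
      filter_upwards [hWb] with ω hω
      exact norm_mul_le_one hω (norm_mul_le_one (norm_mul_le_one (norm_pow_le_one hz₁ _)
        (norm_pow_le_one hz₂ _)) (norm_pow_le_one hz₃ _))))
  refine Eq.trans ?_ (hdec.trans ?_)
  · refine integral_congr_ae ?_
    filter_upwards [hA.epochs.ae_isRegularPath, hS] with ω hω hS
    simp only [F, hω.evalRight_eq hS.1, hω.evalRight_eq (hS.1.trans hS.2.1),
      hω.evalRight_eq ((hS.1.trans hS.2.1).trans hS.2.2)]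
  · refine integral_congr_ae ?_
    filter_upwards [hS] with ω hS
    rw [← hA.integral_pow hlam hS.1 hS.2.1 hS.2.2 hz₁ hz₂ hz₃, ← integral_const_mul]
    refine integral_congr_ae ?_
    filter_upwards [hA.epochs.ae_isRegularPath] with ω' hω
    simp only [F, hω.evalRight_eq hS.1, hω.evalRight_eq (hS.1.trans hS.2.1),
      hω.evalRight_eq ((hS.1.trans hS.2.1).trans hS.2.2)]

end Transform

/-! ### Transforms of the renewal times, and strict bounds -/

section Renewal

variable {Ω : Type*} [MeasurableSpace Ω] {P : Measure Ω} {τ : ℕ → Ω → ℝ}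

theorem prev_eq_sum_gap {Ω : Type*} (τ : ℕ → Ω → ℝ) (n : ℕ) (ω : Ω) :
    prev τ n ω = ∑ k ∈ Finset.range n, gap τ k ω := by
  induction n with
  | zero => simp [prev]
  | succ n ih =>
    rw [Finset.sum_range_succ, ← ih]
    simp [prev, gap]

theorem measurable_prev {β : Type*} [MeasurableSpace β] [Zero β] {f : ℕ → Ω → β}
    (hf : ∀ n, Measurable (f n)) (n : ℕ) : Measurable (prev f n) := by
  cases n with
  | zero => exact measurable_const
  | succ n => exact hf n

theorem IsDelayedRenewal.measurable_gap (hτ : IsDelayedRenewal P τ) (n : ℕ) :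
    Measurable (gap τ n) :=
  (hτ.measurable n).sub (measurable_prev hτ.measurable n)

theorem IsDelayedRenewal.ae_ordered (hτ : IsDelayedRenewal P τ) :
    ∀ᵐ ω ∂P, ∀ n, 0 ≤ prev τ n ω ∧ prev τ n ω ≤ τ n ω := by
  filter_upwards [ae_all_iff.2 hτ.gap_nonneg] with ω h n
  refine ⟨?_, by simpa [gap] using h n⟩
  rw [prev_eq_sum_gap]
  exact Finset.sum_nonneg fun k _ => h k

theorem norm_exp_neg_le_one {c : ℂ} {r : ℝ} (hc : 0 ≤ c.re) (hr : 0 ≤ r) :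
    ‖Complex.exp (-c * r)‖ ≤ 1 := by
  rw [Complex.norm_exp]
  simpa using mul_nonneg hc hr

/-- The Laplace transform of the `n`-th time between observations. -/
def gapTransform (P : Measure Ω) (τ : ℕ → Ω → ℝ) (n : ℕ) (c : ℂ) : ℂ :=
  ∫ ω, Complex.exp (-c * gap τ n ω) ∂P

/-- The Laplace transform `E[exp (-c τₙ₋₁)]`, written in terms of those of the gaps. -/
def prevTransform (P : Measure Ω) (τ : ℕ → Ω → ℝ) : ℕ → ℂ → ℂ
  | 0, _ => 1
  | n + 1, c => gapTransform P τ 0 c * gapTransform P τ 1 c ^ n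

theorem IsDelayedRenewal.gapTransform_eq (hτ : IsDelayedRenewal P τ) (n : ℕ) (c : ℂ) :
    gapTransform P τ (n + 1) c = gapTransform P τ 1 c :=
  ((hτ.identDistrib (n + 1) (by omega)).comp (u := fun r : ℝ => Complex.exp (-c * r))
    (by fun_prop)).integral_eq

theorem IsDelayedRenewal.prevTransform_eq (hτ : IsDelayedRenewal P τ) (n : ℕ) (c : ℂ) :
    prevTransform P τ n c = ∏ k ∈ Finset.range n, gapTransform P τ k c := by
  cases n with
  | zero => simp [prevTransform]
  | succ n =>
    rw [Finset.prod_range_succ', mul_comm]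
    simp [prevTransform, hτ.gapTransform_eq]

/-- τₙ₋₁ is the sum of the gaps with index below n, hence independent of the n-th gap, and its
exponential is a product over those gaps. -/
theorem IsDelayedRenewal.integral_exp_mul (hτ : IsDelayedRenewal P τ) (n : ℕ) (c : ℂ) {f : ℝ → ℂ}
    (hf : Measurable f) :
    ∫ ω, Complex.exp (-c * prev τ n ω) * f (gap τ n ω) ∂P =
      prevTransform P τ n c * ∫ ω, f (gap τ n ω) ∂P := by
  -- The last of the n + 1 independent factors carries `f`; all earlier ones carry the exponential.
  let F : Fin (n + 1) → ℝ → ℂ := fun i => if (i : ℕ) < n then fun r => Complex.exp (-c * r) else f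
  have hF : ∀ i, Measurable (F i) := by
    intro i
    simp only [F]
    split_ifs
    · fun_prop
    · exact hf
  have h := iIndepFun.integral_fun_prod_comp (𝕜 := ℂ)
    (hτ.indep.precomp (g := fun i : Fin (n + 1) => (i : ℕ)) Fin.val_injective) (f := F)
    (fun i => (hτ.measurable_gap i).aemeasurable) (fun i => (hF i).aestronglyMeasurable)
  simp only [Fin.prod_univ_castSucc] at h
  simp only [F, Fin.val_castSucc, Fin.is_lt, if_true, Fin.val_last, lt_irrefl, if_false] at h
  rw [hτ.prevTransform_eq, ← Fin.prod_univ_eq_prod_range (fun k => gapTransform P τ k c) n]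
  refine Eq.trans ?_ h
  congr 1
  ext ω
  rw [← Complex.exp_sum, prev_eq_sum_gap,
    Fin.sum_univ_eq_sum_range (fun k => -c * (gap τ k ω : ℂ)) n, ← Finset.mul_sum]
  push_cast
  rfl

variable [IsProbabilityMeasure P]

theorem integral_lt_one {f : Ω → ℝ} (hf : Measurable f) (hb : ∀ᵐ ω ∂P, 0 ≤ f ω ∧ f ω ≤ 1)
    (hne : P {ω | f ω ≠ 1} ≠ 0) : ∫ ω, f ω ∂P < 1 := by
  have hi : Integrable f P := Integrable.of_bound hf.aestronglyMeasurable 1 (by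
    filter_upwards [hb] with ω h
    rw [Real.norm_eq_abs, abs_le]
    exact ⟨by linarith [h.1], h.2⟩)
  have hpos : 0 < ∫ ω, (1 - f ω) ∂P := by
    rw [integral_pos_iff_support_of_nonneg_ae]
    · refine pos_iff_ne_zero.2 fun h => hne ?_
      convert h using 2
      ext ω
      change f ω ≠ 1 ↔ 1 - f ω ≠ 0
      rw [sub_ne_zero, ne_comm]
    · filter_upwards [hb] with ω h
      simpa using h.2
    · exact (integrable_const _).sub hi
  rw [integral_sub (integrable_const _) hi] at hpos
  simpa using hpos

/-- This is the ratio bound for the geometric series over n: the modulus of exp(-cΔ) is strictly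
below 1 wherever Δ > 0, an event of positive probability. -/
theorem IsDelayedRenewal.norm_gapTransform_lt_one (hτ : IsDelayedRenewal P τ)
    (hΔ : P {ω | gap τ 1 ω ≠ 0} ≠ 0) {c : ℂ} (hc : 0 < c.re) : ‖gapTransform P τ 1 c‖ < 1 := by
  refine (norm_integral_le_integral_norm _).trans_lt (integral_lt_one ?_ ?_ ?_)
  · have := hτ.measurable_gap 1
    fun_prop
  · filter_upwards [hτ.gap_nonneg 1] with ω h using ⟨norm_nonneg _, norm_exp_neg_le_one hc.le h⟩
  · convert hΔ using 4 with ω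
    rw [Complex.norm_exp]
    simp [hc.ne']

theorem re_one_sub_nonneg {z : ℂ} (hz : ‖z‖ ≤ 1) : 0 ≤ (1 - z).re := by
  have := (Complex.re_le_norm z).trans hz
  simpa using this

theorem exponent_re_nonneg {lam : ℝ} (hlam : 0 < lam) (a : ℕ → Ω → ℕ) {z : ℂ} (hz : ‖z‖ ≤ 1) :
    0 ≤ (exponent P lam a z).re := by
  rw [exponent, Complex.re_ofReal_mul]
  exact mul_nonneg hlam.le (re_one_sub_nonneg (norm_pgf_le_one _ hz))

/-- Used at arguments zs with |s| < 1: it makes the argument of the gap transform have positive real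
part even when Re w = 0. -/
theorem exponent_re_pos {lam : ℝ} (hlam : 0 < lam) {a : ℕ → Ω → ℕ} (hm : Measurable (a 0))
    (ha : P {ω | a 0 ω ≠ 0} ≠ 0) {z : ℂ} (hz : ‖z‖ < 1) :
    0 < (exponent P lam a z).re := by
  rw [exponent, Complex.re_ofReal_mul]
  refine mul_pos hlam ?_
  have h : ‖pgf P (a 0) z‖ < 1 := by
    refine (norm_integral_le_integral_norm _).trans_lt (integral_lt_one ?_ ?_ ?_)
    · exact ((measurable_from_top (f := fun n : ℕ => z ^ n)).comp hm).norm
    · exact Filter.Eventually.of_forall fun ω => ⟨norm_nonneg _, norm_pow_le_one hz.le _⟩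
    · convert ha using 4 with ω
      rw [norm_pow]
      exact ⟨fun h hc => h (by simp [hc]), fun h => (pow_lt_one₀ (norm_nonneg _) hz h).ne⟩
  have := (Complex.re_le_norm _).trans_lt h
  simpa using this

theorem exponent_one (lam : ℝ) (a : ℕ → Ω → ℕ) : exponent P lam a 1 = 0 := by
  simp [exponent, pgf]

/-- The difference z^X - 0^X vanishes where X = 0 and has modulus at most |z| elsewhere. This
controls the denominators near s = 0. -/
theorem norm_pgf_sub_pgf_zero_le {X : Ω → ℕ} (hX : Measurable X) {z : ℂ} (hz : ‖z‖ ≤ 1) :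
    ‖pgf P X z - pgf P X 0‖ ≤ ‖z‖ := by
  have hm : ∀ z : ℂ, Measurable fun ω => z ^ X ω := fun z =>
    (measurable_from_top (f := fun n : ℕ => z ^ n)).comp hX
  have hi : ∀ z : ℂ, ‖z‖ ≤ 1 → Integrable (fun ω => z ^ X ω) P := fun z hz =>
    integrable_of_norm_le_one (hm z) (Filter.Eventually.of_forall fun ω => norm_pow_le_one hz _)
  unfold pgf
  rw [← integral_sub (hi z hz) (hi 0 (by simp))]
  refine (norm_integral_le_of_norm_le_const (C := ‖z‖) (Filter.Eventually.of_forall fun ω => ?_)).trans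
    (by simp)
  rcases Nat.eq_zero_or_pos (X ω) with h | h
  · simp [h]
  · rw [zero_pow h.ne', sub_zero, norm_pow]
    exact pow_le_of_le_one (norm_nonneg _) hz h.ne'

end Renewal

/-- A marked Poisson process observed at the epochs of an independent delayed renewal process. -/
structure IsObservedMarkedPoisson {Ω : Type*} [MeasurableSpace Ω] (P : Measure Ω) (lam : ℝ)
    (t : ℕ → Ω → ℝ) (a : ℕ → Ω → ℕ) (τ : ℕ → Ω → ℝ) : Prop where
  lam_pos : 0 < lam
  marked : IsMarkedPoisson P lam t a
  renewal : IsDelayedRenewal P τ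
  indep : IndepFun (fun ω n => τ n ω) (fun ω (s : ℝ≥0) => markedProcess t a s ω) P

/-- The random variable `integrand` with the exit index replaced by a fixed index `n`. -/
def integrandAt {Ω : Type*} (A : ℝ → Ω → ℕ) (τ : ℕ → Ω → ℝ) (n : ℕ) (u v w x y : ℂ)
    (lo hi : Ω → ℝ) (r : ℝ) (ω : Ω) : ℂ :=
  u ^ prev (observed A τ) n ω * v ^ observed A τ n ω *
    Complex.exp (-w * prev τ n ω - x * gap τ n ω) *
    y ^ A r ω * (Ico (lo ω) (hi ω)).indicator (fun _ => (1 : ℂ)) r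

theorem measurable_indicator_Ico {α : Type*} [MeasurableSpace α] {lo hi r : α → ℝ}
    (hlo : Measurable lo) (hhi : Measurable hi) (hr : Measurable r) :
    Measurable fun q => (Ico (lo q) (hi q)).indicator (fun _ => (1 : ℂ)) (r q) := by
  have h : (fun q => (Ico (lo q) (hi q)).indicator (fun _ => (1 : ℂ)) (r q)) =
      ({q | lo q ≤ r q} ∩ {q | r q < hi q}).indicator fun _ => (1 : ℂ) := by
    ext q
    simp [Set.indicator_apply]
  rw [h]
  exact measurable_const.indicator ((measurableSet_le hlo hr).inter (measurableSet_lt hr hhi))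

theorem norm_indicator_le_one (s : Set ℝ) (r : ℝ) :
    ‖s.indicator (fun _ => (1 : ℂ)) r‖ ≤ 1 := by
  by_cases h : r ∈ s <;> simp [h]

theorem setIntegral_exp_indicator {κ : ℂ} (hκ : κ ≠ 0) {lo hi : ℝ} (h0 : 0 ≤ lo) (h : lo ≤ hi) :
    ∫ r in Ici (0 : ℝ), (Ico lo hi).indicator (fun _ => (1 : ℂ)) r * Complex.exp (-κ * r) =
      (Complex.exp (-κ * lo) - Complex.exp (-κ * hi)) / κ := by
  have e : ∀ r : ℝ, (Ico lo hi).indicator (fun _ => (1 : ℂ)) r * Complex.exp (-κ * r) =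
      (Ico lo hi).indicator (fun r : ℝ => Complex.exp (-κ * r)) r := by
    intro r
    simp only [Set.indicator_apply]
    split_ifs <;> simp
  simp_rw [e]
  rw [setIntegral_indicator measurableSet_Ico, inter_eq_right.2 (Ico_subset_Ici_self.trans (Ici_subset_Ici.2 h0)),
    integral_Ico_eq_integral_Ioo, ← integral_Ioc_eq_integral_Ioo,
    ← intervalIntegral.integral_of_le h, integral_exp_mul_complex (neg_ne_zero.2 hκ)]
  rw [div_neg, ← neg_div, neg_sub]

theorem norm_exp_mul_ofReal (θ : ℂ) (r : ℝ) :
    ‖Complex.exp (-θ * r)‖ = Real.exp (-θ.re * r) := by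
  rw [Complex.norm_exp]
  simp

theorem integrable_exp_Ici {b : ℝ} (hb : 0 < b) :
    Integrable (fun r : ℝ => Real.exp (-b * r)) (volume.restrict (Ici 0)) :=
  (integrableOn_Ici_iff_integrableOn_Ioi (by simp)).2 (exp_neg_integrableOn_Ioi 0 hb)

/-! ### Decoupling at the observation times -/

section Observed

variable {Ω : Type*} [MeasurableSpace Ω] {P : Measure Ω}
  {lam : ℝ} {t : ℕ → Ω → ℝ} {a : ℕ → Ω → ℕ} {τ : ℕ → Ω → ℝ}

/-- The measure `dr ⊗ dP` on `[0, ∞) × Ω`. -/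
def timeMeasure (P : Measure Ω) : Measure (ℝ × Ω) := (volume.restrict (Ici (0 : ℝ))).prod P

theorem ae_timeMeasure {p : ℝ → Ω → Prop} (h : ∀ᵐ ω ∂P, ∀ r, 0 ≤ r → p r ω) :
    ∀ᵐ q ∂timeMeasure P, p q.1 q.2 := by
  have h1 : ∀ᵐ q ∂timeMeasure P, q.1 ∈ Ici (0 : ℝ) :=
    Measure.quasiMeasurePreserving_fst.ae (ae_restrict_mem measurableSet_Ici)
  have h2 := Measure.quasiMeasurePreserving_snd (μ := volume.restrict (Ici (0 : ℝ))).ae h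
  filter_upwards [h1, h2] with q hq1 hq2 using hq2 _ hq1

namespace IsObservedMarkedPoisson

/-- Almost surely, everything is in order: the previous observed value is the value of the process
at the previous observation time, and times and observed values are nondecreasing. -/
theorem ae_ordered (h : IsObservedMarkedPoisson P lam t a τ) :
    ∀ᵐ ω ∂P, IsRegularPath t ω ∧ ∀ n, 0 ≤ prev τ n ω ∧ prev τ n ω ≤ τ n ω ∧
      prev (observed (markedProcess t a) τ) n ω = markedProcess t a (prev τ n ω) ω := by
  filter_upwards [h.marked.epochs.ae_isRegularPath, h.renewal.ae_ordered] with ω h1 h2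
  refine ⟨h1, fun n => ⟨(h2 n).1, (h2 n).2, ?_⟩⟩
  cases n with
  | zero => exact h1.zero.symm
  | succ n => rfl

theorem indep_prev (h : IsObservedMarkedPoisson P lam t a τ) (n : ℕ) :
    IndepFun (fun ω => (prev τ n ω, τ n ω)) (fun ω (s : ℝ≥0) => markedProcess t a s ω) P := by
  cases n with
  | zero =>
    exact h.indep.comp (φ := fun x : ℕ → ℝ => ((0 : ℝ), x 0)) (ψ := id) (by fun_prop)
      measurable_id
  | succ n =>
    exact h.indep.comp (φ := fun x : ℕ → ℝ => (x n, x (n + 1))) (ψ := id) (by fun_prop)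
      measurable_id

end IsObservedMarkedPoisson

variable [IsProbabilityMeasure P]

theorem integrable_exp_timeMeasure {θ : ℂ} (hθ : 0 < θ.re) :
    Integrable (fun q : ℝ × Ω => Real.exp (-θ.re * q.1)) (timeMeasure P) :=
  (integrable_exp_Ici hθ).comp_fst P

theorem integrable_exp_mul {θ : ℂ} (hθ : 0 < θ.re) {f : ℝ × Ω → ℂ} (hf : Measurable f)
    (hb : ∀ᵐ ω ∂P, ∀ r, 0 ≤ r → ‖f (r, ω)‖ ≤ 1) :
    Integrable (fun q : ℝ × Ω => Complex.exp (-θ * q.1) * f q) (timeMeasure P) := by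
  refine (integrable_exp_timeMeasure hθ).mono' ?_ ?_
  · exact (Measurable.mul (by fun_prop) hf).aestronglyMeasurable
  · filter_upwards [ae_timeMeasure hb] with q hq
    rw [norm_mul, norm_exp_mul_ofReal]
    exact mul_le_of_le_one_right (Real.exp_pos _).le hq

namespace IsObservedMarkedPoisson

/-- The decoupling formula for times that are functions of `τₙ₋₁` and `τₙ`. -/
theorem integral_pow (h : IsObservedMarkedPoisson P lam t a τ) (n : ℕ) {W : ℝ × ℝ → ℂ}
    {S₁ S₂ S₃ : ℝ × ℝ → ℝ} (hW : Measurable W) (hS₁ : Measurable S₁) (hS₂ : Measurable S₂)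
    (hS₃ : Measurable S₃) (hb : ∀ b c : ℝ, 0 ≤ b → b ≤ c → ‖W (b, c)‖ ≤ 1 ∧ 0 ≤ S₁ (b, c) ∧
      S₁ (b, c) ≤ S₂ (b, c) ∧ S₂ (b, c) ≤ S₃ (b, c))
    {z₁ z₂ z₃ : ℂ} (hz₁ : ‖z₁‖ ≤ 1) (hz₂ : ‖z₂‖ ≤ 1) (hz₃ : ‖z₃‖ ≤ 1) {f : Ω → ℂ}
    (hf : ∀ ω, IsRegularPath t ω → 0 ≤ prev τ n ω → prev τ n ω ≤ τ n ω →
      prev (observed (markedProcess t a) τ) n ω = markedProcess t a (prev τ n ω) ω →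
      f ω = W (prev τ n ω, τ n ω) *
        (z₁ ^ markedProcess t a (S₁ (prev τ n ω, τ n ω)) ω *
        z₂ ^ (markedProcess t a (S₂ (prev τ n ω, τ n ω)) ω -
          markedProcess t a (S₁ (prev τ n ω, τ n ω)) ω) *
        z₃ ^ (markedProcess t a (S₃ (prev τ n ω, τ n ω)) ω -
          markedProcess t a (S₂ (prev τ n ω, τ n ω)) ω))) :
    ∫ ω, f ω ∂P = ∫ ω, W (prev τ n ω, τ n ω) *
      Complex.exp (-(exponent P lam a z₁ * S₁ (prev τ n ω, τ n ω) +
      exponent P lam a z₂ * (S₂ (prev τ n ω, τ n ω) - S₁ (prev τ n ω, τ n ω)) +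
      exponent P lam a z₃ * (S₃ (prev τ n ω, τ n ω) - S₂ (prev τ n ω, τ n ω)))) ∂P := by
  have hm : Measurable fun ω => (prev τ n ω, τ n ω) :=
    (measurable_prev h.renewal.measurable n).prodMk (h.renewal.measurable n)
  refine Eq.trans ?_ (h.marked.integral_pow_randomTime h.lam_pos (hS₁.comp hm) (hS₂.comp hm)
    (hS₃.comp hm) (hW.comp hm) ((h.indep_prev n).comp (φ := fun q => (W q, S₁ q, S₂ q, S₃ q))
      (ψ := id) (by fun_prop) measurable_id) ?_ ?_ hz₁ hz₂ hz₃)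
  · refine integral_congr_ae ?_
    filter_upwards [h.ae_ordered] with ω hω
    exact hf ω hω.1 (hω.2 n).1 (hω.2 n).2.1 (hω.2 n).2.2
  · filter_upwards [h.ae_ordered] with ω hω
    exact (hb _ _ (hω.2 n).1 (hω.2 n).2.1).2
  · filter_upwards [h.ae_ordered] with ω hω
    exact (hb _ _ (hω.2 n).1 (hω.2 n).2.1).1

/-- Given the gap, the increment has generating function exp(-ξ(z)Δₙ), which merges with exp(-cΔₙ).
-/
theorem jointTransform_eq (h : IsObservedMarkedPoisson P lam t a τ) (n : ℕ) {z c : ℂ}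
    (hz : ‖z‖ ≤ 1) (hc : 0 ≤ c.re) :
    jointTransform P (markedProcess t a) τ n z c = gapTransform P τ n (c + exponent P lam a z) := by
  unfold jointTransform gapTransform
  -- Base 1 discards the process before τₙ₋₁, and S₂ = S₃ makes the third interval empty.
  rw [h.integral_pow n (W := fun q => Complex.exp (-c * (q.2 - q.1))) (S₁ := fun q => q.1)
    (S₂ := fun q => q.2) (S₃ := fun q => q.2) (z₁ := 1) (z₂ := z) (z₃ := 1)
    (by fun_prop) (by fun_prop) (by fun_prop) (by fun_prop) ?_ (by simp) hz (by simp)]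
  · congr 1
    ext ω
    rw [← Complex.exp_add]
    congr 1
    simp only [exponent_one, gap]
    push_cast
    ring
  · intro ω _ _ _ ho
    simp only [one_pow, one_mul, mul_one, increment, ho]
    rw [mul_comm]
    simp [gap, observed]
  · intro b c' hb hbc
    refine ⟨?_, hb, hbc, le_rfl⟩
    have := norm_exp_neg_le_one hc (sub_nonneg.2 hbc)
    push_cast at this
    exact this

end IsObservedMarkedPoisson

end Observed

/-! ### Transforms for a fixed index, integrated over time -/

section Observed

variable {Ω : Type*} [MeasurableSpace Ω] {P : Measure Ω}
  {lam : ℝ} {t : ℕ → Ω → ℝ} {a : ℕ → Ω → ℕ} {τ : ℕ → Ω → ℝ}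

namespace IsObservedMarkedPoisson

theorem measurable_observed (h : IsObservedMarkedPoisson P lam t a τ) (n : ℕ) :
    Measurable (observed (markedProcess t a) τ n) :=
  h.marked.measurable_process_at (h.renewal.measurable n)

theorem integral_exp_prev (h : IsObservedMarkedPoisson P lam t a τ) (n : ℕ) (b c : ℂ) :
    ∫ ω, Complex.exp (-b * prev τ n ω) * Complex.exp (-c * gap τ n ω) ∂P =
      prevTransform P τ n b * gapTransform P τ n c :=
  h.renewal.integral_exp_mul n b (f := fun r => Complex.exp (-c * r)) (by fun_prop)

theorem measurable_integrandAt (h : IsObservedMarkedPoisson P lam t a τ) (n : ℕ) (u v w x y : ℂ)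
    {lo hi : Ω → ℝ} (hlo : Measurable lo) (hhi : Measurable hi) :
    Measurable fun q : ℝ × Ω =>
      integrandAt (markedProcess t a) τ n u v w x y lo hi q.1 q.2 := by
  have h1 := h.measurable_observed n
  have h2 := measurable_prev h.measurable_observed n
  have h3 := measurable_prev h.renewal.measurable n
  have h4 := h.renewal.measurable_gap n
  have h5 := h.marked.measurable_process
  have h6 := measurable_indicator_Ico (hlo.comp (measurable_snd (α := ℝ)))
    (hhi.comp (measurable_snd (α := ℝ))) measurable_fst
  unfold integrandAt
  exact Measurable.mul (by fun_prop) h6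

theorem norm_exp_sub_le_one {w x : ℂ} (hw : 0 ≤ w.re) (hx : 0 ≤ x.re) {b c : ℝ} (hb : 0 ≤ b)
    (hc : 0 ≤ c) : ‖Complex.exp (-w * b - x * c)‖ ≤ 1 := by
  rw [sub_eq_add_neg, Complex.exp_add, ← neg_mul]
  exact norm_mul_le_one (norm_exp_neg_le_one hw hb) (norm_exp_neg_le_one hx hc)

theorem norm_integrandAt_le_one (h : IsObservedMarkedPoisson P lam t a τ) {u v w x y : ℂ}
    (hu : ‖u‖ ≤ 1) (hv : ‖v‖ ≤ 1) (hy : ‖y‖ ≤ 1) (hw : 0 ≤ w.re) (hx : 0 ≤ x.re)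
    (lo hi : Ω → ℝ) :
    ∀ᵐ ω ∂P, ∀ n r, ‖integrandAt (markedProcess t a) τ n u v w x y lo hi r ω‖ ≤ 1 := by
  filter_upwards [h.ae_ordered] with ω hω n r
  exact norm_mul_le_one (norm_mul_le_one (norm_mul_le_one (norm_mul_le_one (norm_pow_le_one hu _)
    (norm_pow_le_one hv _)) (norm_exp_sub_le_one hw hx (hω.2 n).1
      (sub_nonneg.2 (hω.2 n).2.1))) (norm_pow_le_one hy _)) (norm_indicator_le_one _ _)

end IsObservedMarkedPoisson

variable [IsProbabilityMeasure P]

/-- At each fixed time the process is averaged out, replacing `F` by the explicit `f`; Fubini then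
allows the time integral of `f` to be done first, along each outcome. -/
theorem integral_timeMeasure_eq {θ : ℂ} (hθ : 0 < θ.re) {F f : ℝ × Ω → ℂ} (hF : Measurable F)
    (hf : Measurable f) (hFb : ∀ᵐ ω ∂P, ∀ r, 0 ≤ r → ‖F (r, ω)‖ ≤ 1)
    (hfb : ∀ᵐ ω ∂P, ∀ r, 0 ≤ r → ‖f (r, ω)‖ ≤ 1)
    (hr : ∀ r, 0 ≤ r → ∫ ω, F (r, ω) ∂P = ∫ ω, f (r, ω) ∂P) :
    ∫ q, Complex.exp (-θ * q.1) * F q ∂timeMeasure P =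
      ∫ ω, (∫ r in Ici (0 : ℝ), Complex.exp (-θ * r) * f (r, ω)) ∂P := by
  have h1 := integral_prod _ (integrable_exp_mul hθ hF hFb)
  have h2 := integral_prod _ (integrable_exp_mul hθ hf hfb)
  have h3 := integral_prod_symm _ (integrable_exp_mul hθ hf hfb)
  rw [timeMeasure, h1, ← h3, h2]
  refine setIntegral_congr_fun measurableSet_Ici fun r hr0 => ?_
  simp only
  rw [integral_const_mul, integral_const_mul, hr r hr0]

namespace IsObservedMarkedPoisson

theorem norm_cexp_neg_le_one {c : ℂ} (hc : 0 ≤ c.re) : ‖Complex.exp (-c)‖ ≤ 1 := by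
  rw [Complex.norm_exp]
  simpa using hc

theorem norm_exp_exponent_le_one (hlam : 0 < lam) {z₁ z₂ z₃ : ℂ} (hz₁ : ‖z₁‖ ≤ 1)
    (hz₂ : ‖z₂‖ ≤ 1) (hz₃ : ‖z₃‖ ≤ 1) {s₁ s₂ s₃ : ℝ} (h1 : 0 ≤ s₁) (h2 : s₁ ≤ s₂) (h3 : s₂ ≤ s₃) :
    ‖Complex.exp (-(exponent P lam a z₁ * s₁ + exponent P lam a z₂ * (s₂ - s₁) +
      exponent P lam a z₃ * (s₃ - s₂)))‖ ≤ 1 := by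
  refine norm_cexp_neg_le_one ?_
  have e1 := mul_nonneg (exponent_re_nonneg (P := P) hlam a hz₁) h1
  have e2 := mul_nonneg (exponent_re_nonneg (P := P) hlam a hz₂) (sub_nonneg.2 h2)
  have e3 := mul_nonneg (exponent_re_nonneg (P := P) hlam a hz₃) (sub_nonneg.2 h3)
  simp only [Complex.add_re, ← Complex.ofReal_sub, Complex.re_mul_ofReal]
  linarith

theorem integrable_exp_prev (h : IsObservedMarkedPoisson P lam t a τ) (n : ℕ) {b c : ℂ}
    (hb : 0 ≤ b.re) (hc : 0 ≤ c.re) :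
    Integrable (fun ω => Complex.exp (-b * prev τ n ω) * Complex.exp (-c * gap τ n ω)) P := by
  have h3 := measurable_prev h.renewal.measurable n
  have h4 := h.renewal.measurable_gap n
  refine integrable_of_norm_le_one (by fun_prop) ?_
  filter_upwards [h.ae_ordered] with ω hω
  exact norm_mul_le_one (norm_exp_neg_le_one hb (hω.2 n).1)
    (norm_exp_neg_le_one hc (sub_nonneg.2 (hω.2 n).2.1))

/-- The contribution of the times before `τₙ₋₁`. -/
theorem integral_before (h : IsObservedMarkedPoisson P lam t a τ) (n : ℕ) {θ u v w x y : ℂ}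
    (hθ : 0 < θ.re) (hu : ‖u‖ ≤ 1) (hv : ‖v‖ ≤ 1) (hy : ‖y‖ ≤ 1) (hw : 0 ≤ w.re) (hx : 0 ≤ x.re)
    (hD : θ + exponent P lam a (u * v * y) - exponent P lam a (u * v) ≠ 0) :
    ∫ q, Complex.exp (-θ * q.1) *
      integrandAt (markedProcess t a) τ n u v w x y (fun _ => 0) (prev τ n) q.1 q.2
        ∂timeMeasure P =
    (prevTransform P τ n (w + exponent P lam a (u * v)) -
      prevTransform P τ n (θ + w + exponent P lam a (u * v * y))) *
      gapTransform P τ n (x + exponent P lam a v) /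
      (θ + exponent P lam a (u * v * y) - exponent P lam a (u * v)) := by
  have huv := norm_mul_le_one hu hv
  have huvy := norm_mul_le_one huv hy
  have h3 := measurable_prev h.renewal.measurable n
  have h4 := h.renewal.measurable_gap n
  have h5 := h.renewal.measurable n
  -- For r < τₙ₋₁ a point before r counts in A(r), Aₙ₋₁ and Aₙ, one in (r, τₙ₋₁] in the last two,
  -- and a later one up to τₙ only in Aₙ: the bases are uvy, uv, v. The minimum keeps the three
  -- times ordered where the indicator vanishes.
  rw [integral_timeMeasure_eq hθ (f := fun q => Complex.exp (-w * prev τ n q.2 - x * gap τ n q.2) *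
      (Ico 0 (prev τ n q.2)).indicator (fun _ => (1 : ℂ)) q.1 *
      Complex.exp (-(exponent P lam a (u * v * y) * (min q.1 (prev τ n q.2) : ℝ) +
        exponent P lam a (u * v) * (prev τ n q.2 - (min q.1 (prev τ n q.2) : ℝ)) +
        exponent P lam a v * (τ n q.2 - prev τ n q.2))))
      (h.measurable_integrandAt n u v w x y measurable_const h3) ?_ ?_ ?_ ?_]
  · have key : ∀ᵐ ω ∂P, ∫ r in Ici (0 : ℝ), Complex.exp (-θ * r) *
        (Complex.exp (-w * prev τ n ω - x * gap τ n ω) *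
        (Ico 0 (prev τ n ω)).indicator (fun _ => (1 : ℂ)) r *
        Complex.exp (-(exponent P lam a (u * v * y) * (min r (prev τ n ω) : ℝ) +
          exponent P lam a (u * v) * (prev τ n ω - (min r (prev τ n ω) : ℝ)) +
          exponent P lam a v * (τ n ω - prev τ n ω)))) =
        (Complex.exp (-(w + exponent P lam a (u * v)) * prev τ n ω) *
            Complex.exp (-(x + exponent P lam a v) * gap τ n ω) -
          Complex.exp (-(θ + w + exponent P lam a (u * v * y)) * prev τ n ω) *
            Complex.exp (-(x + exponent P lam a v) * gap τ n ω)) /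
        (θ + exponent P lam a (u * v * y) - exponent P lam a (u * v)) := by
      filter_upwards [h.ae_ordered] with ω hω
      obtain ⟨hb, hbc, -⟩ := hω.2 n
      -- Everything depending on r is gathered into one exponential with rate θ + ξ(uvy) - ξ(uv),
      -- the denominator of the result.
      have e : ∀ r : ℝ, Complex.exp (-θ * r) *
          (Complex.exp (-w * prev τ n ω - x * gap τ n ω) *
          (Ico 0 (prev τ n ω)).indicator (fun _ => (1 : ℂ)) r *
          Complex.exp (-(exponent P lam a (u * v * y) * (min r (prev τ n ω) : ℝ) +
            exponent P lam a (u * v) * (prev τ n ω - (min r (prev τ n ω) : ℝ)) +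
            exponent P lam a v * (τ n ω - prev τ n ω)))) =
          Complex.exp (-(w + exponent P lam a (u * v)) * prev τ n ω -
            (x + exponent P lam a v) * gap τ n ω) *
          ((Ico 0 (prev τ n ω)).indicator (fun _ => (1 : ℂ)) r *
          Complex.exp (-(θ + exponent P lam a (u * v * y) - exponent P lam a (u * v)) * r)) := by
        intro r
        by_cases hr : r ∈ Ico 0 (prev τ n ω)
        · rw [Set.indicator_of_mem hr, min_eq_left hr.2.le, mul_one, one_mul, ← Complex.exp_add,
            ← Complex.exp_add, ← Complex.exp_add]
          congr 1
          simp only [gap]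
          push_cast
          ring
        · rw [Set.indicator_of_notMem hr]
          simp
      simp_rw [e]
      rw [integral_const_mul, setIntegral_exp_indicator hD le_rfl hb, mul_div_assoc', mul_sub,
        ← Complex.exp_add, ← Complex.exp_add, ← Complex.exp_add, ← Complex.exp_add]
      congr 3
      · simp
        ring
      · ring
    have hre := fun {z : ℂ} (hz : ‖z‖ ≤ 1) => exponent_re_nonneg (P := P) h.lam_pos a hz
    rw [integral_congr_ae key, integral_div, integral_sub, h.integral_exp_prev,
      h.integral_exp_prev, sub_mul]
    · exact h.integrable_exp_prev n (add_nonneg hw (hre huv)) (add_nonneg hx (hre hv))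
    · exact h.integrable_exp_prev n (add_nonneg (add_nonneg hθ.le hw) (hre huvy))
        (add_nonneg hx (hre hv))
  · refine Measurable.mul (Measurable.mul (by fun_prop) (measurable_indicator_Ico (by fun_prop)
      (by fun_prop) (by fun_prop))) ?_
    fun_prop
  · filter_upwards [h.norm_integrandAt_le_one hu hv hy hw hx (fun _ => 0) (prev τ n)] with ω hω r _
      using hω n r
  · filter_upwards [h.ae_ordered] with ω hω r hr
    obtain ⟨hb, hbc, -⟩ := hω.2 n
    exact norm_mul_le_one (norm_mul_le_one (norm_exp_sub_le_one hw hx hb (sub_nonneg.2 hbc))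
      (norm_indicator_le_one _ _)) (norm_exp_exponent_le_one h.lam_pos huvy huv hv
      (le_min hr hb) (min_le_right _ _) hbc)
  · intro r hr
    refine h.integral_pow n (W := fun q => Complex.exp (-w * q.1 - x * (q.2 - q.1 : ℝ)) *
      (Ico 0 q.1).indicator (fun _ => (1 : ℂ)) r) (S₁ := fun q => min r q.1)
      (S₂ := fun q => q.1) (S₃ := fun q => q.2) ?_ (by fun_prop) (by fun_prop) (by fun_prop) ?_
      huvy huv hv ?_
    · exact Measurable.mul (by fun_prop) (measurable_indicator_Ico (by fun_prop) (by fun_prop)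
        measurable_const)
    · intro b c hb hbc
      exact ⟨norm_mul_le_one (norm_exp_sub_le_one hw hx hb (sub_nonneg.2 hbc))
        (norm_indicator_le_one _ _), le_min hr hb, min_le_right _ _, hbc⟩
    · intro ω hω hb hbc ho
      simp only [integrandAt, ho]
      by_cases hr : r ∈ Ico 0 (prev τ n ω)
      · rw [Set.indicator_of_mem hr, min_eq_left hr.2.le]
        obtain ⟨d, hd⟩ := Nat.exists_eq_add_of_le (hω.mono (a := a) hr.2.le)
        obtain ⟨d', hd'⟩ := Nat.exists_eq_add_of_le (hω.mono (a := a) hbc)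
        simp only [observed, hd', hd, gap, Nat.add_sub_cancel_left]
        ring
      · rw [Set.indicator_of_notMem hr]
        simp

/-- The contribution of the times from `τₙ₋₁` to `τₙ`. -/
theorem integral_between (h : IsObservedMarkedPoisson P lam t a τ) (n : ℕ) {θ u v w x y : ℂ}
    (hθ : 0 < θ.re) (hu : ‖u‖ ≤ 1) (hv : ‖v‖ ≤ 1) (hy : ‖y‖ ≤ 1) (hw : 0 ≤ w.re) (hx : 0 ≤ x.re)
    (hD : θ + exponent P lam a (v * y) - exponent P lam a v ≠ 0) :
    ∫ q, Complex.exp (-θ * q.1) *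
      integrandAt (markedProcess t a) τ n u v w x y (prev τ n) (τ n) q.1 q.2 ∂timeMeasure P =
    prevTransform P τ n (θ + w + exponent P lam a (u * v * y)) *
      ((gapTransform P τ n (x + exponent P lam a v) -
        gapTransform P τ n (θ + x + exponent P lam a (v * y))) /
      (θ + exponent P lam a (v * y) - exponent P lam a v)) := by
  have huv := norm_mul_le_one hu hv
  have hvy := norm_mul_le_one hv hy
  have huvy := norm_mul_le_one huv hy
  have h3 := measurable_prev h.renewal.measurable n
  have h4 := h.renewal.measurable_gap n
  have h5 := h.renewal.measurable n
  -- For τₙ₋₁ ≤ r < τₙ the time r splits the last gap instead, so the bases are uvy, vy, v. Clamping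
  -- r to [τₙ₋₁, τₙ] preserves the order off the support of the indicator.
  rw [integral_timeMeasure_eq hθ (f := fun q => Complex.exp (-w * prev τ n q.2 - x * gap τ n q.2) *
      (Ico (prev τ n q.2) (τ n q.2)).indicator (fun _ => (1 : ℂ)) q.1 *
      Complex.exp (-(exponent P lam a (u * v * y) * prev τ n q.2 +
        exponent P lam a (v * y) *
          ((max (min q.1 (τ n q.2)) (prev τ n q.2) : ℝ) - prev τ n q.2) +
        exponent P lam a v * (τ n q.2 - (max (min q.1 (τ n q.2)) (prev τ n q.2) : ℝ)))))
      (h.measurable_integrandAt n u v w x y h3 h5) ?_ ?_ ?_ ?_]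
  · have key : ∀ᵐ ω ∂P, ∫ r in Ici (0 : ℝ), Complex.exp (-θ * r) *
        (Complex.exp (-w * prev τ n ω - x * gap τ n ω) *
        (Ico (prev τ n ω) (τ n ω)).indicator (fun _ => (1 : ℂ)) r *
        Complex.exp (-(exponent P lam a (u * v * y) * prev τ n ω +
          exponent P lam a (v * y) * ((max (min r (τ n ω)) (prev τ n ω) : ℝ) - prev τ n ω) +
          exponent P lam a v * (τ n ω - (max (min r (τ n ω)) (prev τ n ω) : ℝ))))) =
        (Complex.exp (-(θ + w + exponent P lam a (u * v * y)) * prev τ n ω) *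
            Complex.exp (-(x + exponent P lam a v) * gap τ n ω) -
          Complex.exp (-(θ + w + exponent P lam a (u * v * y)) * prev τ n ω) *
            Complex.exp (-(θ + x + exponent P lam a (v * y)) * gap τ n ω)) /
        (θ + exponent P lam a (v * y) - exponent P lam a v) := by
      filter_upwards [h.ae_ordered] with ω hω
      obtain ⟨hb, hbc, -⟩ := hω.2 n
      have e : ∀ r : ℝ, Complex.exp (-θ * r) *
          (Complex.exp (-w * prev τ n ω - x * gap τ n ω) *
          (Ico (prev τ n ω) (τ n ω)).indicator (fun _ => (1 : ℂ)) r *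
          Complex.exp (-(exponent P lam a (u * v * y) * prev τ n ω +
            exponent P lam a (v * y) * ((max (min r (τ n ω)) (prev τ n ω) : ℝ) - prev τ n ω) +
            exponent P lam a v * (τ n ω - (max (min r (τ n ω)) (prev τ n ω) : ℝ))))) =
          Complex.exp (-(w + exponent P lam a (u * v * y) - exponent P lam a (v * y)) * prev τ n ω -
            x * gap τ n ω - exponent P lam a v * τ n ω) *
          ((Ico (prev τ n ω) (τ n ω)).indicator (fun _ => (1 : ℂ)) r *
          Complex.exp (-(θ + exponent P lam a (v * y) - exponent P lam a v) * r)) := by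
        intro r
        by_cases hr : r ∈ Ico (prev τ n ω) (τ n ω)
        · rw [Set.indicator_of_mem hr, min_eq_left hr.2.le, max_eq_left hr.1, mul_one, one_mul,
            ← Complex.exp_add, ← Complex.exp_add, ← Complex.exp_add]
          congr 1
          ring
        · rw [Set.indicator_of_notMem hr]
          simp
      simp_rw [e]
      rw [integral_const_mul, setIntegral_exp_indicator hD hb hbc, mul_div_assoc', mul_sub,
        ← Complex.exp_add, ← Complex.exp_add, ← Complex.exp_add, ← Complex.exp_add]
      congr 3
      · simp only [gap]
        push_cast
        ring
      · simp only [gap]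
        push_cast
        ring
    have hre := fun {z : ℂ} (hz : ‖z‖ ≤ 1) => exponent_re_nonneg (P := P) h.lam_pos a hz
    have hb := add_nonneg (add_nonneg hθ.le hw) (hre huvy)
    rw [integral_congr_ae key, integral_div, integral_sub, h.integral_exp_prev,
      h.integral_exp_prev, ← mul_sub, mul_div_assoc]
    · exact h.integrable_exp_prev n hb (add_nonneg hx (hre hv))
    · exact h.integrable_exp_prev n hb (add_nonneg (add_nonneg hθ.le hx) (hre hvy))
  · refine Measurable.mul (Measurable.mul (by fun_prop) (measurable_indicator_Ico (by fun_prop)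
      (by fun_prop) (by fun_prop))) ?_
    fun_prop
  · filter_upwards [h.norm_integrandAt_le_one hu hv hy hw hx (prev τ n) (τ n)] with ω hω r _
      using hω n r
  · filter_upwards [h.ae_ordered] with ω hω r hr
    obtain ⟨hb, hbc, -⟩ := hω.2 n
    exact norm_mul_le_one (norm_mul_le_one (norm_exp_sub_le_one hw hx hb (sub_nonneg.2 hbc))
      (norm_indicator_le_one _ _)) (norm_exp_exponent_le_one h.lam_pos huvy hvy hv
      hb (le_max_right _ _) (max_le (min_le_right _ _) hbc))
  · intro r hr
    refine h.integral_pow n (W := fun q => Complex.exp (-w * q.1 - x * (q.2 - q.1 : ℝ)) *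
      (Ico q.1 q.2).indicator (fun _ => (1 : ℂ)) r) (S₁ := fun q => q.1)
      (S₂ := fun q => max (min r q.2) q.1) (S₃ := fun q => q.2) ?_ (by fun_prop) (by fun_prop)
      (by fun_prop) ?_ huvy hvy hv ?_
    · exact Measurable.mul (by fun_prop) (measurable_indicator_Ico (by fun_prop) (by fun_prop)
        measurable_const)
    · intro b c hb hbc
      exact ⟨norm_mul_le_one (norm_exp_sub_le_one hw hx hb (sub_nonneg.2 hbc))
        (norm_indicator_le_one _ _), hb, le_max_right _ _, max_le (min_le_right _ _) hbc⟩
    · intro ω hω hb hbc ho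
      simp only [integrandAt, ho]
      by_cases hr : r ∈ Ico (prev τ n ω) (τ n ω)
      · rw [Set.indicator_of_mem hr, min_eq_left hr.2.le, max_eq_left hr.1]
        obtain ⟨d, hd⟩ := Nat.exists_eq_add_of_le (hω.mono (a := a) hr.1)
        obtain ⟨d', hd'⟩ := Nat.exists_eq_add_of_le (hω.mono (a := a) hr.2.le)
        simp only [observed, hd', hd, gap, Nat.add_sub_cancel_left]
        ring
      · rw [Set.indicator_of_notMem hr]
        simp

end IsObservedMarkedPoisson

end Observed

/-! ### Summation over thresholds and extraction of coefficients -/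

section Exit

variable {Ω : Type*} {f : ℕ → Ω → ℕ} {ω : Ω}

/-- The thresholds with exit index n form the block from `prev f n` up to, but excluding, `f n`.
Existence of an exit excludes the default value 0 of the infimum of an empty set. -/
theorem sInf_exit_eq_iff (hmono : ∀ n, prev f n ω ≤ f n ω) {p : ℕ} (hex : ∃ n, p < f n ω) (n : ℕ) :
    sInf {n | p < f n ω} = n ↔ prev f n ω ≤ p ∧ p < f n ω := by
  have hm : Monotone fun n => f n ω := monotone_nat_of_le_succ fun n => hmono (n + 1)
  constructor
  · rintro rfl
    refine ⟨?_, Nat.sInf_mem hex⟩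
    rcases h : sInf {n | p < f n ω} with _ | m
    · exact Nat.zero_le _
    · exact not_lt.1 (Nat.notMem_of_lt_sInf (m := m) (s := {n | p < f n ω}) (by omega))
  · rintro ⟨h1, h2⟩
    refine le_antisymm (Nat.sInf_le h2) ?_
    by_contra! hc
    cases n with
    | zero => omega
    | succ m => exact absurd (Nat.sInf_mem hex) (not_lt.2 ((hm (Nat.lt_succ_iff.1 hc)).trans h1))

variable {𝕜 : Type*} [NormedField 𝕜]

/-- Summation by parts over the thresholds: the generating function of the exit values. -/
theorem hasSum_exit [CompleteSpace 𝕜] (hmono : ∀ n, prev f n ω ≤ f n ω) (hex : ∀ p, ∃ n, p < f n ω) {k : ℕ → 𝕜}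
    {C : ℝ} (hk : ∀ n, ‖k n‖ ≤ C) {s : 𝕜} (hs : ‖s‖ < 1) :
    HasSum (fun n => k n * (s ^ prev f n ω - s ^ f n ω))
      ((1 - s) * ∑' p, s ^ p * k (sInf {n | p < f n ω})) := by
  have hs1 : s ≠ 1 := by
    rintro rfl
    simp at hs
  have hsum : Summable fun p => s ^ p * k (sInf {n | p < f n ω}) := by
    refine Summable.of_norm_bounded (g := fun p => ‖s‖ ^ p * C)
      ((summable_geometric_of_lt_one (norm_nonneg _) hs).mul_right C) fun p => ?_
    rw [norm_mul, norm_pow]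
    gcongr
    exact hk _
  -- Thresholds are grouped by exit index; each group is a finite block, summed below as a geometric
  -- progression.
  have h := (hsum.hasSum.tsum_fiberwise fun p => sInf {n | p < f n ω}).mul_left (1 - s)
  refine h.congr_fun ?_
  intro n
  have hfib : (fun p => sInf {n | p < f n ω}) ⁻¹' {n} = (Finset.Ico (prev f n ω) (f n ω) : Finset ℕ) := by
    ext p
    rw [mem_preimage, mem_singleton_iff, sInf_exit_eq_iff hmono (hex p)]
    simp
  have hfun : ∀ p ∈ Finset.Ico (prev f n ω) (f n ω),
      s ^ p * k (sInf {n | p < f n ω}) = s ^ p * k n := by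
    intro p hp
    rw [(sInf_exit_eq_iff hmono (hex p) n).2 (by simpa using hp)]
  rw [hfib, Finset.tsum_subtype' (Finset.Ico (prev f n ω) (f n ω))
    (fun p => s ^ p * k (sInf {n | p < f n ω})), Finset.sum_congr rfl hfun, ← Finset.sum_mul,
    geom_sum_Ico' hs1 (hmono n)]
  field_simp [sub_ne_zero.2 hs1.symm]

/-- Both differences are geometric sums over the same block. The bound serves as a dominating term,
because the real differences telescope over consecutive blocks. -/
theorem norm_pow_sub_pow_le {s : 𝕜} (hs : ‖s‖ < 1) {m n : ℕ} (hmn : m ≤ n) :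
    ‖s ^ m - s ^ n‖ ≤ ‖1 - s‖ / (1 - ‖s‖) * (‖s‖ ^ m - ‖s‖ ^ n) := by
  have hs1 : s ≠ 1 := by
    rintro rfl
    simp at hs
  have e : s ^ m - s ^ n = (1 - s) * ∑ p ∈ Finset.Ico m n, s ^ p := by
    rw [geom_sum_Ico' hs1 hmn]
    field_simp [sub_ne_zero.2 hs1.symm]
  have e' : (‖s‖ ^ m - ‖s‖ ^ n) / (1 - ‖s‖) = ∑ p ∈ Finset.Ico m n, ‖s‖ ^ p :=
    (geom_sum_Ico' hs.ne hmn).symm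
  rw [e, norm_mul, div_mul_eq_mul_div, mul_div_assoc, e']
  gcongr
  refine (norm_sum_le _ _).trans (le_of_eq ?_)
  simp

theorem measurable_sInf_exit [MeasurableSpace Ω] (hf : ∀ n, Measurable (f n)) (p : ℕ) :
    Measurable fun ω => sInf {n | p < f n ω} := by
  have hm : ∀ n, MeasurableSet {ω | p < f n ω} := fun n => measurableSet_lt measurable_const (hf n)
  refine measurable_to_countable' fun n => ?_
  -- The second part of the union is the event of no exit, where the infimum takes its default value
  -- 0.
  have h : (fun ω => sInf {n | p < f n ω}) ⁻¹' {n} =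
      ({ω | p < f n ω} ∩ ⋂ m ∈ Finset.range n, {ω | p < f m ω}ᶜ) ∪
        ((⋂ m, {ω | p < f m ω}ᶜ) ∩ {_ω | n = 0}) := by
    ext ω
    simp only [mem_preimage, mem_singleton_iff, mem_union, mem_inter_iff, mem_iInter,
      mem_compl_iff, Finset.mem_range]
    constructor
    · rintro rfl
      rcases ({n | p < f n ω}).eq_empty_or_nonempty with he | hne
      · right
        refine ⟨fun m hm => ?_, by simp [he]⟩
        have : m ∈ {n | p < f n ω} := hm
        rw [he] at this
        exact this
      · exact Or.inl ⟨Nat.sInf_mem hne, fun m hm =>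
          Nat.notMem_of_lt_sInf (s := {n | p < f n ω}) hm⟩
    · rintro (⟨h1, h2⟩ | ⟨h1, h2⟩)
      · refine le_antisymm (Nat.sInf_le h1) (not_lt.1 fun hc =>
          h2 _ hc (Nat.sInf_mem (s := {n | p < f n ω}) ⟨n, h1⟩))
      · have he : {n | p < f n ω} = ∅ := by
          ext m
          exact ⟨fun hm => h1 m hm, fun hm => absurd hm (notMem_empty m)⟩
        rw [he, Nat.sInf_empty]
        exact h2.symm
  rw [h]
  refine ((hm n).inter (Finset.measurableSet_biInter _ fun m _ => (hm m).compl)).union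
    ((MeasurableSet.iInter fun m => (hm m).compl).inter (MeasurableSet.const _))

end Exit

open Filter Topology in
/-- The operator `Dinv k` extracts the `k`-th coefficient of the expansion of `φ s / (1 - s)`. -/
theorem analyticAt_and_Dinv_eq {c : ℕ → ℂ} {φ : ℂ → ℂ}
    (h : ∀ᶠ s in 𝓝 (0 : ℂ), HasSum (fun p => s ^ p * c p) (1 / (1 - s) * φ s)) :
    AnalyticAt ℂ φ 0 ∧ ∀ k, Dinv k φ = c k := by
  have hp : HasFPowerSeriesAt (fun s => 1 / (1 - s) * φ s)
      (FormalMultilinearSeries.ofScalars ℂ c) 0 := by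
    rw [hasFPowerSeriesAt_iff]
    filter_upwards [h] with s hs
    simpa [FormalMultilinearSeries.coeff_ofScalars] using hs
  constructor
  · have h1 : AnalyticAt ℂ (fun s : ℂ => (1 - s) * (1 / (1 - s) * φ s)) 0 :=
      (analyticAt_const.sub analyticAt_id).mul hp.analyticAt
    refine h1.congr ?_
    have hne : ∀ᶠ s : ℂ in 𝓝 0, s ≠ 1 := isOpen_ne.mem_nhds (by simp)
    filter_upwards [hne] with s hs
    field_simp [sub_ne_zero.2 hs.symm]
  · intro k
    have h2 := hp.eq_formalMultilinearSeries hp.analyticAt.hasFPowerSeriesAt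
    have h3 := congrArg (fun q : FormalMultilinearSeries ℂ ℂ ℂ => q.coeff k) h2
    simp only [FormalMultilinearSeries.coeff_ofScalars] at h3
    rw [Dinv, h3]

/-! ### Almost sure exit, and the transform up to τₙ -/

section Observed

variable {Ω : Type*} [MeasurableSpace Ω] {P : Measure Ω} [IsProbabilityMeasure P]
  {lam : ℝ} {t : ℕ → Ω → ℝ} {a : ℕ → Ω → ℕ} {τ : ℕ → Ω → ℝ}

namespace IsObservedMarkedPoisson

/-- The index n + 1 appears because `prevTransform` at n + 1 is the transform of τₙ. -/
theorem integral_pow_observed (h : IsObservedMarkedPoisson P lam t a τ) (n : ℕ) {z : ℂ}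
    (hz : ‖z‖ ≤ 1) :
    ∫ ω, z ^ observed (markedProcess t a) τ n ω ∂P =
      prevTransform P τ (n + 1) (exponent P lam a z) := by
  rw [h.integral_pow n (W := fun _ => 1) (S₁ := fun q => q.2) (S₂ := fun q => q.2)
    (S₃ := fun q => q.2) (z₁ := z) (z₂ := 1) (z₃ := 1) (by fun_prop) (by fun_prop) (by fun_prop)
    (by fun_prop) ?_ hz (by simp) (by simp)]
  · have := h.renewal.integral_exp_mul (n + 1) (exponent P lam a z) (f := fun _ => 1) (by fun_prop)
    simp only [mul_one, integral_const, probReal_univ, one_smul] at this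
    rw [← this]
    congr 1
    ext ω
    simp [prev]
  · intro ω _ _ _ _
    simp [observed]
  · intro b c hb hbc
    exact ⟨by simp, hb.trans hbc, le_rfl, le_rfl⟩

open Filter Topology in
theorem tendsto_prevTransform (h : IsObservedMarkedPoisson P lam t a τ)
    (hΔ : P {ω | gap τ 1 ω ≠ 0} ≠ 0) {c : ℂ} (hc : 0 < c.re) :
    Tendsto (fun n => prevTransform P τ (n + 1) c) atTop (𝓝 0) := by
  have := (tendsto_pow_atTop_nhds_zero_of_norm_lt_one
    (h.renewal.norm_gapTransform_lt_one hΔ hc)).const_mul (gapTransform P τ 0 c)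
  simpa [prevTransform] using this

open Filter Topology in
/-- Almost surely the observed values exceed every threshold. -/
theorem ae_exists_lt (h : IsObservedMarkedPoisson P lam t a τ)
    (ha : P {ω | a 0 ω ≠ 0} ≠ 0) (hΔ : P {ω | gap τ 1 ω ≠ 0} ≠ 0) (p : ℕ) :
    ∀ᵐ ω ∂P, ∃ n, p < observed (markedProcess t a) τ n ω := by
  have hlim := (h.tendsto_prevTransform hΔ (exponent_re_pos (P := P) h.lam_pos
    (h.marked.measurable 0) ha (z := (1 / 2 : ℝ)) (by norm_num))).norm
  -- Markov's inequality: if no observed value exceeds p, then 2^{-Aₙ} ≥ 2^{-p} for every n, while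
  -- the mean of 2^{-Aₙ} tends to 0.
  have hle : ∀ n, (1 / 2 : ℝ) ^ p * P.real {ω | ¬ ∃ n, p < observed (markedProcess t a) τ n ω} ≤
      ‖prevTransform P τ (n + 1) (exponent P lam a ((1 / 2 : ℝ) : ℂ))‖ := by
    intro n
    rw [← h.integral_pow_observed n (by norm_num)]
    have hr : ∫ ω, (((1 / 2 : ℝ) : ℂ) ^ observed (markedProcess t a) τ n ω) ∂P =
        ((∫ ω, (1 / 2 : ℝ) ^ observed (markedProcess t a) τ n ω ∂P : ℝ) : ℂ) := by
      rw [← integral_complex_ofReal]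
      push_cast
      rfl
    rw [hr, Complex.norm_real]
    refine le_trans ?_ (le_abs_self _)
    have hi : Integrable (fun ω => (1 / 2 : ℝ) ^ observed (markedProcess t a) τ n ω) P := by
      refine Integrable.of_bound (C := 1) ?_ (Eventually.of_forall fun ω => ?_)
      · have := h.measurable_observed n
        exact Measurable.aestronglyMeasurable (by fun_prop)
      · rw [norm_pow]
        exact pow_le_one₀ (norm_nonneg _) (by norm_num)
    refine le_trans ?_ (mul_meas_ge_le_integral_of_nonneg
      (Eventually.of_forall fun ω => by positivity) hi ((1 / 2 : ℝ) ^ p))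
    refine mul_le_mul_of_nonneg_left (measureReal_mono fun ω hω => ?_) (by positivity)
    have hω' : ¬ ∃ n, p < observed (markedProcess t a) τ n ω := hω
    push Not at hω'
    change (1 / 2 : ℝ) ^ p ≤ (1 / 2 : ℝ) ^ observed (markedProcess t a) τ n ω
    exact pow_le_pow_of_le_one (by norm_num) (by norm_num) (hω' n)
  have h0 := ge_of_tendsto' hlim hle
  rw [norm_zero] at h0
  have h1 : P.real {ω | ¬ ∃ n, p < observed (markedProcess t a) τ n ω} = 0 :=
    le_antisymm (nonpos_of_mul_nonpos_right h0 (by positivity)) measureReal_nonneg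
  rw [ae_iff]
  exact (measureReal_eq_zero_iff).1 h1

/-- The transform of the contribution of the event `ν = n`, before the threshold is fixed. -/
def exitTransform (P : Measure Ω) (A : ℝ → Ω → ℕ) (τ : ℕ → Ω → ℝ) (θ u v w x y : ℂ) (n : ℕ) : ℂ :=
  ∫ q, Complex.exp (-θ * q.1) *
    integrandAt A τ n u v w x y (fun _ => 0) (τ n) q.1 q.2 ∂timeMeasure P

theorem integrable_integrandAt (h : IsObservedMarkedPoisson P lam t a τ) (n : ℕ) {θ u v w x y : ℂ}
    (hθ : 0 < θ.re) (hu : ‖u‖ ≤ 1) (hv : ‖v‖ ≤ 1) (hy : ‖y‖ ≤ 1) (hw : 0 ≤ w.re) (hx : 0 ≤ x.re)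
    {lo hi : Ω → ℝ} (hlo : Measurable lo) (hhi : Measurable hi) :
    Integrable (fun q : ℝ × Ω => Complex.exp (-θ * q.1) *
      integrandAt (markedProcess t a) τ n u v w x y lo hi q.1 q.2) (timeMeasure P) := by
  refine integrable_exp_mul hθ (h.measurable_integrandAt n u v w x y hlo hhi) ?_
  filter_upwards [h.norm_integrandAt_le_one hu hv hy hw hx lo hi] with ω hω r _ using hω n r

theorem indicator_Ico_add {b c : ℝ} (hb : 0 ≤ b) (hbc : b ≤ c) (r : ℝ) :
    (Ico 0 c).indicator (fun _ => (1 : ℂ)) r =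
      (Ico 0 b).indicator (fun _ => (1 : ℂ)) r + (Ico b c).indicator (fun _ => (1 : ℂ)) r := by
  rw [← Ico_union_Ico_eq_Ico hb hbc, Set.indicator_union_of_disjoint]
  exact Ico_disjoint_Ico_same

theorem exitTransform_eq (h : IsObservedMarkedPoisson P lam t a τ) (n : ℕ) {θ u v w x y : ℂ}
    (hθ : 0 < θ.re) (hu : ‖u‖ ≤ 1) (hv : ‖v‖ ≤ 1) (hy : ‖y‖ ≤ 1) (hw : 0 ≤ w.re) (hx : 0 ≤ x.re)
    (hD : θ + exponent P lam a (u * v * y) - exponent P lam a (u * v) ≠ 0)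
    (hD' : θ + exponent P lam a (v * y) - exponent P lam a v ≠ 0) :
    exitTransform P (markedProcess t a) τ θ u v w x y n =
    (prevTransform P τ n (w + exponent P lam a (u * v)) -
      prevTransform P τ n (θ + w + exponent P lam a (u * v * y))) *
      gapTransform P τ n (x + exponent P lam a v) /
      (θ + exponent P lam a (u * v * y) - exponent P lam a (u * v)) +
    prevTransform P τ n (θ + w + exponent P lam a (u * v * y)) *
      ((gapTransform P τ n (x + exponent P lam a v) -
        gapTransform P τ n (θ + x + exponent P lam a (v * y))) /
      (θ + exponent P lam a (v * y) - exponent P lam a v)) := by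
  have h3 := measurable_prev h.renewal.measurable n
  have h5 := h.renewal.measurable n
  rw [← h.integral_before n hθ hu hv hy hw hx hD, ← h.integral_between n hθ hu hv hy hw hx hD',
    ← integral_add (h.integrable_integrandAt n hθ hu hv hy hw hx measurable_const h3)
      (h.integrable_integrandAt n hθ hu hv hy hw hx h3 h5), exitTransform]
  refine integral_congr_ae (ae_timeMeasure (p := fun r ω => Complex.exp (-θ * r) *
    integrandAt (markedProcess t a) τ n u v w x y (fun _ => 0) (τ n) r ω =
    Complex.exp (-θ * r) *
      integrandAt (markedProcess t a) τ n u v w x y (fun _ => 0) (prev τ n) r ω +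
    Complex.exp (-θ * r) *
      integrandAt (markedProcess t a) τ n u v w x y (prev τ n) (τ n) r ω) ?_)
  filter_upwards [h.ae_ordered] with ω hω r _
  simp only [integrandAt]
  rw [indicator_Ico_add (hω.2 n).1 (hω.2 n).2.1]
  ring

end IsObservedMarkedPoisson

end Observed

/-! ### The exit functional and its generating function over thresholds -/

section Observed

variable {Ω : Type*} [MeasurableSpace Ω] {P : Measure Ω}
  {lam : ℝ} {t : ℕ → Ω → ℝ} {a : ℕ → Ω → ℕ} {τ : ℕ → Ω → ℝ}

namespace IsObservedMarkedPoisson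

theorem measurable_integrand (h : IsObservedMarkedPoisson P lam t a τ) (p : ℕ) (u v w x y : ℂ)
    {lo hi : ℕ → Ω → ℝ} (hlo : ∀ n, Measurable (lo n)) (hhi : ∀ n, Measurable (hi n)) :
    Measurable fun q : ℝ × Ω => integrand (markedProcess t a) τ p u v w x y
      (fun ω => lo (exitIndex (markedProcess t a) τ p ω) ω)
      (fun ω => hi (exitIndex (markedProcess t a) τ p ω) ω) q.1 q.2 := by
  -- The index is first a free variable in a countable space; the random exit index is substituted
  -- afterwards, in the interval endpoints as well.
  have h1 : Measurable fun z : (ℝ × Ω) × ℕ => integrandAt (markedProcess t a) τ z.2 u v w x y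
      (lo z.2) (hi z.2) z.1.1 z.1.2 :=
    measurable_from_prod_countable_left fun n =>
      h.measurable_integrandAt n u v w x y (hlo n) (hhi n)
  have h2 : Measurable fun q : ℝ × Ω => (q, exitIndex (markedProcess t a) τ p q.2) :=
    measurable_id.prodMk ((measurable_sInf_exit h.measurable_observed p).comp measurable_snd)
  have h3 := h1.comp h2
  simp only [Function.comp_def, integrandAt] at h3
  simp only [integrand, preExitTime]
  exact h3

theorem norm_integrand_le_one (h : IsObservedMarkedPoisson P lam t a τ) (p : ℕ) {u v w x y : ℂ}
    (hu : ‖u‖ ≤ 1) (hv : ‖v‖ ≤ 1) (hy : ‖y‖ ≤ 1) (hw : 0 ≤ w.re) (hx : 0 ≤ x.re)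
    (lo hi : Ω → ℝ) :
    ∀ᵐ ω ∂P, ∀ r, ‖integrand (markedProcess t a) τ p u v w x y lo hi r ω‖ ≤ 1 := by
  filter_upwards [h.norm_integrandAt_le_one hu hv hy hw hx lo hi] with ω hω r
  exact hω (exitIndex (markedProcess t a) τ p ω) r

variable [IsProbabilityMeasure P]

theorem integrable_integrand_timeMeasure (h : IsObservedMarkedPoisson P lam t a τ) (p : ℕ)
    {θ u v w x y : ℂ} (hθ : 0 < θ.re)
    (hu : ‖u‖ ≤ 1) (hv : ‖v‖ ≤ 1) (hy : ‖y‖ ≤ 1) (hw : 0 ≤ w.re) (hx : 0 ≤ x.re)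
    {lo hi : ℕ → Ω → ℝ} (hlo : ∀ n, Measurable (lo n)) (hhi : ∀ n, Measurable (hi n)) :
    Integrable (fun q : ℝ × Ω => Complex.exp (-θ * q.1) *
      integrand (markedProcess t a) τ p u v w x y
      (fun ω => lo (exitIndex (markedProcess t a) τ p ω) ω)
      (fun ω => hi (exitIndex (markedProcess t a) τ p ω) ω) q.1 q.2) (timeMeasure P) := by
  refine integrable_exp_mul hθ (h.measurable_integrand p u v w x y hlo hhi) ?_
  filter_upwards [h.norm_integrand_le_one p hu hv hy hw hx _ _] with ω hω r _ using hω r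

/-- The Laplace transform of the exit functional as an integral over `[0, ∞) × Ω`. -/
def jointIntegral (P : Measure Ω) (A : ℝ → Ω → ℕ) (τ : ℕ → Ω → ℝ) (θ u v w x y : ℂ) (p : ℕ) : ℂ :=
  ∫ q, Complex.exp (-θ * q.1) * integrand A τ p u v w x y (fun _ => 0) (exitTime A τ p) q.1 q.2
    ∂timeMeasure P

/-- `hasSum_exit` holds at almost every (r, ω) and is integrated by dominated convergence on both
sides. `S` is the generating function over thresholds; its closed form comes from the second series.
-/
theorem exists_hasSum (h : IsObservedMarkedPoisson P lam t a τ)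
    (ha : P {ω | a 0 ω ≠ 0} ≠ 0) (hΔ : P {ω | gap τ 1 ω ≠ 0} ≠ 0) {θ u v w x y : ℂ}
    (hθ : 0 < θ.re) (hu : ‖u‖ ≤ 1) (hv : ‖v‖ ≤ 1) (hy : ‖y‖ ≤ 1) (hw : 0 ≤ w.re) (hx : 0 ≤ x.re)
    {s : ℂ} (hs : ‖s‖ < 1) :
    ∃ S, HasSum (fun p => s ^ p * jointIntegral P (markedProcess t a) τ θ u v w x y p) S ∧
      HasSum (fun n => exitTransform P (markedProcess t a) τ θ (u * s) v w x y n -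
        exitTransform P (markedProcess t a) τ θ u (v * s) w x y n) ((1 - s) * S) := by
  let A := markedProcess t a
  let K : ℕ → ℝ × Ω → ℂ := fun n q => Complex.exp (-θ * q.1) *
    integrandAt A τ n u v w x y (fun _ => 0) (τ n) q.1 q.2
  let J : ℕ → ℝ × Ω → ℂ := fun p q => Complex.exp (-θ * q.1) *
    integrand A τ p u v w x y (fun _ => 0) (exitTime A τ p) q.1 q.2
  let E : ℝ × Ω → ℝ := fun q => Real.exp (-θ.re * q.1)
  have hJK : ∀ p q, J p q = K (sInf {n | p < observed A τ n q.2}) q := fun p q => rfl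
  have hJi : ∀ p, Integrable (J p) (timeMeasure P) := fun p =>
    h.integrable_integrand_timeMeasure p hθ hu hv hy hw hx (lo := fun _ _ => 0) (hi := τ)
      (fun _ => measurable_const) h.renewal.measurable
  have hE : Integrable E (timeMeasure P) := integrable_exp_timeMeasure hθ
  have hreg : ∀ᵐ q ∂timeMeasure P, (∀ n, prev (observed A τ) n q.2 ≤ observed A τ n q.2) ∧
      (∀ p, ∃ n, p < observed A τ n q.2) ∧ ∀ n, ‖K n q‖ ≤ E q := by
    refine ae_timeMeasure (p := fun r ω => (∀ n, prev (observed A τ) n ω ≤ observed A τ n ω) ∧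
      (∀ p, ∃ n, p < observed A τ n ω) ∧ ∀ n, ‖K n (r, ω)‖ ≤ E (r, ω)) ?_
    filter_upwards [h.ae_ordered, ae_all_iff.2 (h.ae_exists_lt ha hΔ),
      ae_all_iff.2 fun n => h.norm_integrandAt_le_one hu hv hy hw hx (fun _ => 0) (τ n)]
      with ω h1 h2 h3 r _
    refine ⟨fun n => ?_, h2, fun n => ?_⟩
    · rw [(h1.2 n).2.2]
      exact h1.1.mono (h1.2 n).2.1
    · rw [norm_mul, norm_exp_mul_ofReal]
      exact mul_le_of_le_one_right (Real.exp_pos _).le (h3 n n r)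
  have hKi : ∀ u v : ℂ, ‖u‖ ≤ 1 → ‖v‖ ≤ 1 → ∀ n, Integrable (fun q : ℝ × Ω =>
      Complex.exp (-θ * q.1) * integrandAt A τ n u v w x y (fun _ => 0) (τ n) q.1 q.2)
      (timeMeasure P) := fun u v hu hv n =>
    h.integrable_integrandAt n hθ hu hv hy hw hx measurable_const (h.renewal.measurable n)
  have hus : ‖u * s‖ ≤ 1 := norm_mul_le_one hu hs.le
  have hvs : ‖v * s‖ ≤ 1 := norm_mul_le_one hv hs.le
  -- The powers of s are absorbed into u for Aₙ₋₁ and into v for Aₙ.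
  have hKs : ∀ n q, K n q * (s ^ prev (observed A τ) n q.2 - s ^ observed A τ n q.2) =
      Complex.exp (-θ * q.1) * integrandAt A τ n (u * s) v w x y (fun _ => 0) (τ n) q.1 q.2 -
      Complex.exp (-θ * q.1) * integrandAt A τ n u (v * s) w x y (fun _ => 0) (τ n) q.1 q.2 := by
    intro n q
    simp only [K, integrandAt, mul_pow]
    ring
  have hKsi : ∀ n, ∫ q, K n q * (s ^ prev (observed A τ) n q.2 - s ^ observed A τ n q.2)
      ∂timeMeasure P = exitTransform P A τ θ (u * s) v w x y n -
        exitTransform P A τ θ u (v * s) w x y n := by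
    intro n
    simp_rw [hKs]
    exact integral_sub (hKi _ _ hus hv n) (hKi _ _ hu hvs n)
  have hgeom := summable_geometric_of_lt_one (norm_nonneg s) hs
  have hJb : ∀ᵐ q ∂timeMeasure P, ∀ p, ‖s ^ p * J p q‖ ≤ ‖s‖ ^ p * E q := by
    filter_upwards [hreg] with q hq p
    rw [norm_mul, norm_pow, hJK]
    gcongr
    exact hq.2.2 _
  refine ⟨∫ q, ∑' p, s ^ p * J p q ∂timeMeasure P, ?_, ?_⟩
  · have := hasSum_integral_of_dominated_convergence (μ := timeMeasure P)
      (F := fun p q => s ^ p * J p q) (f := fun q => ∑' p, s ^ p * J p q)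
      (fun p q => ‖s‖ ^ p * E q) (fun p => ((hJi p).const_mul _).aestronglyMeasurable)
      (fun p => by filter_upwards [hJb] with q hq using hq p)
      (Filter.Eventually.of_forall fun q => hgeom.mul_right _)
      (by simpa only [tsum_mul_right] using hE.const_mul _)
      (by
        filter_upwards [hJb] with q hq
        exact (Summable.of_norm_bounded (hgeom.mul_right _) hq).hasSum)
    simp only [integral_const_mul] at this
    exact this
  · have hs1 : 0 < 1 - ‖s‖ := sub_pos.2 hs
    -- The dominating series is summed by `hasSum_exit` itself, with k = 1 and the real number ‖s‖:
    -- its blocks add up to 1.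
    have hbs : ∀ᵐ q ∂timeMeasure P, HasSum (fun n => E q * (‖1 - s‖ / (1 - ‖s‖) *
        (‖s‖ ^ prev (observed A τ) n q.2 - ‖s‖ ^ observed A τ n q.2)))
        (E q * (‖1 - s‖ / (1 - ‖s‖))) := by
      filter_upwards [hreg] with q hq
      have := hasSum_exit hq.1 hq.2.1 (k := fun _ => (1 : ℝ)) (C := 1) (by simp) (s := ‖s‖)
        (by simpa using hs)
      simp only [one_mul, mul_one, tsum_geometric_of_lt_one (norm_nonneg s) hs,
        mul_inv_cancel₀ hs1.ne'] at this
      simpa using (this.mul_left (‖1 - s‖ / (1 - ‖s‖))).mul_left (E q)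
    have key : HasSum (fun n => ∫ q, K n q *
        (s ^ prev (observed A τ) n q.2 - s ^ observed A τ n q.2) ∂timeMeasure P)
        (∫ q, (1 - s) * ∑' p, s ^ p * J p q ∂timeMeasure P) := by
      refine hasSum_integral_of_dominated_convergence (fun n q => E q * (‖1 - s‖ / (1 - ‖s‖) *
        (‖s‖ ^ prev (observed A τ) n q.2 - ‖s‖ ^ observed A τ n q.2))) ?_ ?_ ?_ ?_ ?_
      · intro n
        simp_rw [hKs]
        exact ((hKi _ _ hus hv n).sub (hKi _ _ hu hvs n)).aestronglyMeasurable
      · intro n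
        filter_upwards [hreg] with q hq
        rw [norm_mul]
        exact mul_le_mul (hq.2.2 n) (norm_pow_sub_pow_le hs (hq.1 n)) (norm_nonneg _)
          (Real.exp_pos _).le
      · filter_upwards [hbs] with q hq using hq.summable
      · refine (hE.mul_const (‖1 - s‖ / (1 - ‖s‖))).congr ?_
        filter_upwards [hbs] with q hq using hq.tsum_eq.symm
      · filter_upwards [hreg] with q hq
        exact hasSum_exit hq.1 hq.2.1 (k := fun n => K n q) hq.2.2 hs
    rw [integral_const_mul, funext hKsi] at key
    exact key

end IsObservedMarkedPoisson

end Observed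

theorem add_exponent_sub_exponent {Ω : Type*} [MeasurableSpace Ω] {P : Measure Ω} {lam : ℝ}
    {a : ℕ → Ω → ℕ} (θ z z' : ℂ) :
    θ + exponent P lam a z' - exponent P lam a z =
      θ + lam * pgf P (a 0) z - lam * pgf P (a 0) z' := by
  unfold exponent
  ring

/-! ### Closed form of the kernel, and the Laplace transforms -/

section Observed

variable {Ω : Type*} [MeasurableSpace Ω] {P : Measure Ω} [IsProbabilityMeasure P]
  {lam : ℝ} {t : ℕ → Ω → ℝ} {a : ℕ → Ω → ℕ} {τ : ℕ → Ω → ℝ}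

/-- At s = 0 the two generating functions cancel and θ remains; their difference contributes at most
2λ|s|, too little to cancel θ. -/
theorem denominator_ne_zero {X : Ω → ℕ} (hX : Measurable X) (hlam : 0 < lam) {θ z z' s : ℂ}
    (hs : ‖s‖ < 1) (hsθ : 2 * lam * ‖s‖ < ‖θ‖) (hz : ‖z‖ ≤ ‖s‖) (hz' : ‖z'‖ ≤ ‖s‖) :
    θ + lam * pgf P X z - lam * pgf P X z' ≠ 0 := by
  intro h0
  have e : θ = lam * ((pgf P X z' - pgf P X 0) - (pgf P X z - pgf P X 0)) := by
    linear_combination h0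
  have h1 : ‖θ‖ ≤ lam * (‖s‖ + ‖s‖) := by
    rw [e, norm_mul, Complex.norm_real, Real.norm_of_nonneg hlam.le]
    refine mul_le_mul_of_nonneg_left ((norm_sub_le _ _).trans (add_le_add ?_ ?_)) hlam.le
    · exact (norm_pgf_sub_pgf_zero_le hX (hz'.trans hs.le)).trans hz'
    · exact (norm_pgf_sub_pgf_zero_le hX (hz.trans hs.le)).trans hz
  linarith

namespace IsObservedMarkedPoisson

/-- Replacing u by us or v by vs yields the same product uvs, so the factors for τₙ₋₁ agree in both
transforms and only those for the last gap are subtracted. `hden` covers the one denominator that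
does not involve s. -/
theorem hasSum_kernelFun (h : IsObservedMarkedPoisson P lam t a τ)
    (ha : P {ω | a 0 ω ≠ 0} ≠ 0) (hΔ : P {ω | gap τ 1 ω ≠ 0} ≠ 0) {θ u v w x y : ℂ}
    (hθ : 0 < θ.re) (hu : ‖u‖ ≤ 1) (hv : ‖v‖ ≤ 1) (hy : ‖y‖ ≤ 1) (hw : 0 ≤ w.re) (hx : 0 ≤ x.re)
    (hden : θ + lam * pgf P (a 0) v - lam * pgf P (a 0) (v * y) ≠ 0)
    {s : ℂ} (hs : ‖s‖ < 1) (hsθ : 2 * lam * ‖s‖ < ‖θ‖) :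
    HasSum (fun n => exitTransform P (markedProcess t a) τ θ (u * s) v w x y n -
        exitTransform P (markedProcess t a) τ θ u (v * s) w x y n)
      (kernelFun lam (pgf P (a 0)) (jointTransform P (markedProcess t a) τ 0)
        (jointTransform P (markedProcess t a) τ 1) θ u v w x y s) := by
  have hsmall : ∀ {z : ℂ}, ‖z‖ ≤ 1 → ‖z * s‖ ≤ ‖s‖ := fun {z} hz => by
    rw [norm_mul]
    exact mul_le_of_le_one_left (norm_nonneg _) hz
  have huv := norm_mul_le_one hu hv
  have hvy := norm_mul_le_one hv hy
  have huvy := norm_mul_le_one huv hy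
  have hm := h.marked.measurable 0
  have hD1 := denominator_ne_zero (P := P) hm h.lam_pos hs hsθ (hsmall huv) (hsmall huvy)
  have hD2 := denominator_ne_zero (P := P) hm h.lam_pos hs hsθ (hsmall hv) (hsmall hvy)
  have hθw : 0 ≤ (θ + w).re := add_nonneg hθ.le hw
  have hθx : 0 ≤ (θ + x).re := add_nonneg hθ.le hx
  have hre : ∀ {c z : ℂ}, 0 ≤ c.re → ‖z‖ ≤ 1 → 0 < (c + exponent P lam a (z * s)).re :=
    fun {c z} hc hz => add_pos_of_nonneg_of_pos hc
      (exponent_re_pos h.lam_pos hm ha ((hsmall hz).trans_lt hs))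
  have hL1 := h.renewal.norm_gapTransform_lt_one hΔ (hre hw huv)
  have hL2 := h.renewal.norm_gapTransform_lt_one hΔ (hre hθw huvy)
  have hle : ∀ {z : ℂ}, ‖z‖ ≤ 1 → ‖z * s‖ ≤ 1 := fun hz => (hsmall hz).trans hs.le
  have e1 : u * s * v = u * v * s := by ring
  have e2 : u * v * s * y = u * v * y * s := by ring
  have e3 : u * (v * s) = u * v * s := by ring
  have e4 : v * s * y = v * y * s := by ring
  have hF : ∀ n, exitTransform P (markedProcess t a) τ θ (u * s) v w x y n -
      exitTransform P (markedProcess t a) τ θ u (v * s) w x y n = _ := fun n =>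
    congrArg₂ (· - ·)
      (h.exitTransform_eq n hθ (hle hu) hv hy hw hx
        (by rwa [add_exponent_sub_exponent, e1, e2]) (by rwa [add_exponent_sub_exponent]))
      (h.exitTransform_eq n hθ hu (hle hv) hy hw hx
        (by rwa [add_exponent_sub_exponent, e3, e2]) (by rwa [add_exponent_sub_exponent, e4]))
  simp only [e1, e2, e3, e4, add_exponent_sub_exponent] at hF
  -- The term n = 0 is split off: there τ₋₁ = 0, the part before τ₋₁ vanishes, and what remains is
  -- Γ₀.
  rw [← hasSum_nat_add_iff' 1, Finset.sum_range_one]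
  simp only [hF, h.renewal.gapTransform_eq]
  simp only [prevTransform, kernelFun, B₁, B₂, B₃, Γof, h.jointTransform_eq _ hv hx,
    h.jointTransform_eq _ (hle hv) hx, h.jointTransform_eq _ (hle huv) hw,
    h.jointTransform_eq _ (hle huvy) hθw, h.jointTransform_eq _ hvy hθx,
    h.jointTransform_eq _ (hle hvy) hθx]
  -- For n ≥ 1 the factors γ₀ γ^{n-1} sum to B₂ in `s1` and to B₃ in `s2`; `s3` assembles B₁(B₂ -
  -- B₃) + Γ B₃.
  have s1 := (hasSum_geometric_of_norm_lt_one hL1).mul_left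
    (gapTransform P τ 0 (w + exponent P lam a (u * v * s)))
  have s2 := (hasSum_geometric_of_norm_lt_one hL2).mul_left
    (gapTransform P τ 0 (θ + w + exponent P lam a (u * v * y * s)))
  have s3 := ((s1.sub s2).mul_left ((gapTransform P τ 1 (x + exponent P lam a v) -
    gapTransform P τ 1 (x + exponent P lam a (v * s))) /
    (θ + lam * pgf P (a 0) (u * v * s) - lam * pgf P (a 0) (u * v * y * s)))).add
    (s2.mul_left ((gapTransform P τ 1 (x + exponent P lam a v) -
        gapTransform P τ 1 (θ + x + exponent P lam a (v * y))) /
      (θ + lam * pgf P (a 0) v - lam * pgf P (a 0) (v * y)) -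
      (gapTransform P τ 1 (x + exponent P lam a (v * s)) -
        gapTransform P τ 1 (θ + x + exponent P lam a (v * y * s))) /
      (θ + lam * pgf P (a 0) (v * s) - lam * pgf P (a 0) (v * y * s))))
  convert! s3 using 1
  · ext n
    ring
  · simp only [div_eq_mul_inv]
    ring

theorem laplace_G_eq (h : IsObservedMarkedPoisson P lam t a τ) (p : ℕ)
    {θ u v w x y : ℂ} (hθ : 0 < θ.re)
    (hu : ‖u‖ ≤ 1) (hv : ‖v‖ ≤ 1) (hy : ‖y‖ ≤ 1) (hw : 0 ≤ w.re) (hx : 0 ≤ x.re) :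
    laplace (G P (markedProcess t a) τ p u v w x y) θ =
      jointIntegral P (markedProcess t a) τ θ u v w x y p := by
  have h1 := integral_prod _ (h.integrable_integrand_timeMeasure p hθ hu hv hy hw hx
    (lo := fun _ _ => 0) (hi := τ) (fun _ => measurable_const) h.renewal.measurable)
  refine Eq.trans ?_ h1.symm
  simp only [integral_const_mul]
  rfl

theorem analyticAt_and_laplace_eq (h : IsObservedMarkedPoisson P lam t a τ)
    (ha : P {ω | a 0 ω ≠ 0} ≠ 0) (hΔ : P {ω | gap τ 1 ω ≠ 0} ≠ 0) {θ u v w x y : ℂ}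
    (hθ : 0 < θ.re) (hu : ‖u‖ ≤ 1) (hv : ‖v‖ ≤ 1) (hy : ‖y‖ ≤ 1) (hw : 0 ≤ w.re) (hx : 0 ≤ x.re)
    (hden : θ + lam * pgf P (a 0) v - lam * pgf P (a 0) (v * y) ≠ 0) :
    AnalyticAt ℂ (kernelFun lam (pgf P (a 0)) (jointTransform P (markedProcess t a) τ 0)
      (jointTransform P (markedProcess t a) τ 1) θ u v w x y) 0 ∧
    ∀ p, Dinv p (kernelFun lam (pgf P (a 0)) (jointTransform P (markedProcess t a) τ 0)
      (jointTransform P (markedProcess t a) τ 1) θ u v w x y) =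
        jointIntegral P (markedProcess t a) τ θ u v w x y p := by
  refine analyticAt_and_Dinv_eq ?_
  have hθ0 : 0 < ‖θ‖ := hθ.trans_le (Complex.re_le_norm θ)
  have h1 : ∀ᶠ s : ℂ in nhds 0, ‖s‖ < 1 :=
    (continuous_norm.tendsto' (0 : ℂ) 0 norm_zero).eventually (gt_mem_nhds one_pos)
  have h2 : ∀ᶠ s : ℂ in nhds 0, 2 * lam * ‖s‖ < ‖θ‖ :=
    ((continuous_const.mul continuous_norm).tendsto' (0 : ℂ) 0 (by simp)).eventually
      (gt_mem_nhds hθ0)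
  filter_upwards [h1, h2] with s hs hsθ
  obtain ⟨S, hS1, hS2⟩ := h.exists_hasSum ha hΔ hθ hu hv hy hw hx hs
  -- The same series over n has been summed twice, so (1 - s) S is the kernel.
  have hS3 := hS2.unique (h.hasSum_kernelFun ha hΔ hθ hu hv hy hw hx hden hs hsθ)
  have hs1 : 1 - s ≠ 0 := by
    intro h0
    rw [← sub_eq_zero.1 h0] at hs
    simp at hs
  rwa [← hS3, ← mul_assoc, one_div, inv_mul_cancel₀ hs1, one_mul]

theorem laplaceConverges (h : IsObservedMarkedPoisson P lam t a τ) (p : ℕ)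
    {θ u v w x y : ℂ} (hθ : 0 < θ.re)
    (hu : ‖u‖ ≤ 1) (hv : ‖v‖ ≤ 1) (hy : ‖y‖ ≤ 1) (hw : 0 ≤ w.re) (hx : 0 ≤ x.re)
    {lo hi : ℕ → Ω → ℝ} (hlo : ∀ n, Measurable (lo n)) (hhi : ∀ n, Measurable (hi n)) :
    LaplaceConverges (fun r => ∫ ω, integrand (markedProcess t a) τ p u v w x y
      (fun ω => lo (exitIndex (markedProcess t a) τ p ω) ω)
      (fun ω => hi (exitIndex (markedProcess t a) τ p ω) ω) r ω ∂P) θ := by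
  have h1 := (h.integrable_integrand_timeMeasure p hθ hu hv hy hw hx hlo hhi).integral_prod_left
  simp only [integral_const_mul] at h1
  exact h1

theorem integrable_integrand (h : IsObservedMarkedPoisson P lam t a τ) (p : ℕ)
    {u v w x y : ℂ} (hu : ‖u‖ ≤ 1) (hv : ‖v‖ ≤ 1) (hy : ‖y‖ ≤ 1) (hw : 0 ≤ w.re) (hx : 0 ≤ x.re)
    {lo hi : ℕ → Ω → ℝ} (hlo : ∀ n, Measurable (lo n)) (hhi : ∀ n, Measurable (hi n)) (r : ℝ) :
    Integrable (integrand (markedProcess t a) τ p u v w x y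
      (fun ω => lo (exitIndex (markedProcess t a) τ p ω) ω)
      (fun ω => hi (exitIndex (markedProcess t a) τ p ω) ω) r) P := by
  have hm := (h.measurable_integrand p u v w x y hlo hhi).comp (measurable_prodMk_left (x := r))
  simp only [Function.comp_def] at hm
  refine integrable_of_norm_le_one hm ?_
  filter_upwards [h.norm_integrand_le_one p hu hv hy hw hx _ _] with ω hω using hω r

end IsObservedMarkedPoisson

end Observed

end DelayedPassage

end

/-! ### The theorem -/

open DelayedPassage in
theorem mainTheorem3 {Ω : Type*} [MeasurableSpace Ω] (P : Measure Ω) [IsProbabilityMeasure P]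
    (lam : ℝ) (hlam : 0 < lam)
    (t : ℕ → Ω → ℝ) (a : ℕ → Ω → ℕ) (hA : IsMarkedPoisson P lam t a)
    (τ : ℕ → Ω → ℝ) (hτ : IsDelayedRenewal P τ)
    (hind : IndepFun (fun ω n => τ n ω) (fun ω (s : ℝ≥0) => markedProcess t a s ω) P)
    (ha : P {ω | a 0 ω ≠ 0} ≠ 0) (hΔ : P {ω | gap τ 1 ω ≠ 0} ≠ 0)
    (p : ℕ) (θ u v w x y : ℂ) (hθ : 0 < θ.re)
    (hu : ‖u‖ ≤ 1) (hv : ‖v‖ ≤ 1) (hy : ‖y‖ ≤ 1) (hw : 0 ≤ w.re) (hx : 0 ≤ x.re)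
    (hden : θ + lam * pgf P (a 0) v - lam * pgf P (a 0) (v * y) ≠ 0) :
    (∀ᵐ ω ∂P, ∃ n, p < observed (markedProcess t a) τ n ω) ∧
    (∀ r : ℝ, 0 ≤ r →
      Integrable (integrand (markedProcess t a) τ p u v w x y
        (fun _ => 0) (preExitTime (markedProcess t a) τ p) r) P ∧
      Integrable (integrand (markedProcess t a) τ p u v w x y
        (preExitTime (markedProcess t a) τ p) (exitTime (markedProcess t a) τ p) r) P ∧
      Integrable (integrand (markedProcess t a) τ p u v w x y
        (fun _ => 0) (exitTime (markedProcess t a) τ p) r) P) ∧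
    LaplaceConverges (G₁ P (markedProcess t a) τ p u v w x y) θ ∧
    LaplaceConverges (G₂ P (markedProcess t a) τ p u v w x y) θ ∧
    LaplaceConverges (G P (markedProcess t a) τ p u v w x y) θ ∧
    laplace (G P (markedProcess t a) τ p u v w x y) θ =
      laplace (G₁ P (markedProcess t a) τ p u v w x y) θ +
        laplace (G₂ P (markedProcess t a) τ p u v w x y) θ ∧
    AnalyticAt ℂ (kernelFun lam (pgf P (a 0)) (jointTransform P (markedProcess t a) τ 0)
      (jointTransform P (markedProcess t a) τ 1) θ u v w x y) 0 ∧
    laplace (G P (markedProcess t a) τ p u v w x y) θ =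
      Dinv p (kernelFun lam (pgf P (a 0)) (jointTransform P (markedProcess t a) τ 0)
        (jointTransform P (markedProcess t a) τ 1) θ u v w x y) := by
  have h : IsObservedMarkedPoisson P lam t a τ := ⟨hlam, hA, hτ, hind⟩
  have hτm := hτ.measurable
  have hpm := measurable_prev hτ.measurable
  -- The constant lower endpoint is presented as a family indexed by n, like the endpoints `prev τ`
  -- and `τ`.
  let z : ℕ → Ω → ℝ := fun _ _ => 0
  have h0 : ∀ n, Measurable (z n) := fun _ => measurable_const
  have hi₁ := h.integrable_integrand p hu hv hy hw hx (lo := z) (hi := prev τ) h0 hpm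
  have hi₂ := h.integrable_integrand p hu hv hy hw hx (lo := prev τ) (hi := τ) hpm hτm
  have hc₁ : LaplaceConverges (G₁ P (markedProcess t a) τ p u v w x y) θ :=
    h.laplaceConverges p hθ hu hv hy hw hx (lo := z) (hi := prev τ) h0 hpm
  have hc₂ : LaplaceConverges (G₂ P (markedProcess t a) τ p u v w x y) θ :=
    h.laplaceConverges p hθ hu hv hy hw hx (lo := prev τ) (hi := τ) hpm hτm
  have hadd : ∀ r, G P (markedProcess t a) τ p u v w x y r =
      G₁ P (markedProcess t a) τ p u v w x y r + G₂ P (markedProcess t a) τ p u v w x y r := by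
    intro r
    rw [G, G₁, G₂]
    refine Eq.trans ?_ (integral_add (hi₁ r) (hi₂ r))
    refine integral_congr_ae ?_
    filter_upwards [h.ae_ordered] with ω hω
    obtain ⟨hb, hbc, -⟩ := hω.2 (exitIndex (markedProcess t a) τ p ω)
    simp only [integrand, exitTime, preExitTime,
      IsObservedMarkedPoisson.indicator_Ico_add hb hbc, mul_add]
  obtain ⟨han, hD⟩ := h.analyticAt_and_laplace_eq ha hΔ hθ hu hv hy hw hx hden
  refine ⟨h.ae_exists_lt ha hΔ p, fun r _ => ⟨hi₁ r, hi₂ r,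
    h.integrable_integrand p hu hv hy hw hx (lo := z) (hi := τ) h0 hτm r⟩, hc₁, hc₂,
    h.laplaceConverges p hθ hu hv hy hw hx (lo := z) (hi := τ) h0 hτm, ?_, han, ?_⟩
  · unfold laplace
    rw [← integral_add hc₁ hc₂]
    simp only [hadd, mul_add]
  · rw [hD, h.laplace_G_eq p hθ hu hv hy hw hx]
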